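/- The grid has point set $\mathbb{Z}^2$, and its edges are the pairs of points at distance one. A path is a simple path of the grid with at least one edge; a bend of a path is a pair of consecutive edges, one horizontal and one vertical. Two paths intersect if they share a grid edge. A $B_1$-EPG (single bend) representation of a finite simple graph $G$ assigns to each vertex a path with at most one bend so that two distinct vertices are adjacent if and only if their paths intersect. It is Helly if every pairwise intersecting subfamily of the paths has a common grid edge; Helly-$B_1$ EPG is the class of graphs that have a Helly $B_1$-EPG representation. A path with one bend has shape $\llcorner$, $\lrcorner$, $\ulcorner$ or $\urcorner$ according to whether its two arms leave the bend point to the right and up, left and up, right and down, or left and down; a path without bends counts as a degenerate $\llcorner$. For a set $S$ of shapes, $[S]$ is the class of graphs that have a $B_1$-EPG representation in which all paths have shapes in $S$. The bat graph is obtained from a $4$-cycle $C_4$ and four disjoint copies of $K_{2,4}$ by identifying a vertex of the larger part of each copy with a distinct vertex of the $C_4$. The $3$-sun $S_3$ is a triangle together with three pairwise nonadjacent vertices, each adjacent to exactly two vertices of the triangle, a different pair for each. Four paths $P_1,P_2,P_3,P_4$, each with exactly one bend, form a square-frame if for some $x_1<x_2$ and $y_1<y_2$ they bend at $(x_1,y_1)$,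 $(x_2,y_1)$, $(x_1,y_2)$, $(x_2,y_2)$ with shapes $\llcorner$, $\lrcorner$, $\ulcorner$, $\urcorner$ respectively, the pairs $P_1P_2$, $P_1P_3$, $P_2P_4$, $P_3P_4$ intersect, and the pairs $P_1P_4$, $P_2P_3$ do not. **Theorem.** $[\llcorner]\subsetneq[\llcorner,\urcorner]\subsetneq$ Helly-$B_1$ EPG, and Helly-$B_1$ EPG is incomparable (neither class contains the other) with $[\llcorner,\ulcorner]$ and with $[\llcorner,\ulcorner,\urcorner]$. Moreover: 1. in every single bend representation of the bat graph, the paths of the four vertices of the $C_4$, in a suitable order, form a square-frame; the bat graph is in Helly-$B_1$ EPG but in none of $[\llcorner,\urcorner]$, $[\llcorner,\ulcorner]$, $[\llcorner,\ulcorner,\urcorner]$; 2. the $3$-sun $S_3$ is in $[\llcorner,\ulcorner]$, and hence in $[\llcorner,\ulcorner,\urcorner]$, but not in Helly-$B_1$ EPG. -/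

import Mathlib

/-- The (infinite) rectangular grid: its points are pairs of integers, and its edges are the pairs
of points at Euclidean distance one. -/
def grid : SimpleGraph (ℤ × ℤ) where
  Adj p q := (p.2 = q.2 ∧ |p.1 - q.1| = 1) ∨ (p.1 = q.1 ∧ |p.2 - q.2| = 1)
  symm := ⟨fun p q h => by
    rcases h with ⟨h1, h2⟩ | ⟨h1, h2⟩
    · exact Or.inl ⟨h1.symm, by rw [abs_sub_comm]; exact h2⟩
    · exact Or.inr ⟨h1.symm, by rw [abs_sub_comm]; exact h2⟩⟩
  loopless := ⟨fun p h => by simp at h⟩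

/-- A (simple) path of the grid with at least one edge. -/
structure GridPath where
  source : ℤ × ℤ
  target : ℤ × ℤ
  walk : grid.Walk source target
  isPath : walk.IsPath
  length_pos : 0 < walk.length

namespace GridPath

/-- The `i`-th point of the path (meaningful for `i ≤ P.walk.length`). -/
def pt (P : GridPath) (i : ℕ) : ℤ × ℤ := P.walk.getVert i

/-- The set of grid edges of a path. -/
def edgeSet (P : GridPath) : Set (Sym2 (ℤ × ℤ)) := {e | e ∈ P.walk.edges}

/-- Two paths (edge-)intersect when they share at least one grid edge. -/
def Intersects (P Q : GridPath) : Prop := (P.edgeSet ∩ Q.edgeSet).Nonempty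

/-- The consecutive edges `pt i – pt (i+1)` and `pt (i+1) – pt (i+2)` of the path form a bend:
exactly one of them is vertical (has equal first coordinates). The bend point is `pt (i+1)`. -/
def IsBend (P : GridPath) (i : ℕ) : Prop :=
  i + 2 ≤ P.walk.length ∧
    ¬ ((P.pt i).1 = (P.pt (i + 1)).1 ↔ (P.pt (i + 1)).1 = (P.pt (i + 2)).1)

instance (P : GridPath) : DecidablePred P.IsBend := fun i => by
  unfold IsBend; infer_instance

/-- The number of bends of a path. -/
def numBends (P : GridPath) : ℕ := ((Finset.range P.walk.length).filter P.IsBend).card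

end GridPath

/-- The four shapes of single bend paths. -/
inductive Shape where
  /-- `⌞`: from the bend point, the arms go right and up. -/
  | llcorner
  /-- `⌟`: from the bend point, the arms go left and up. -/
  | lrcorner
  /-- `⌜`: from the bend point, the arms go right and down. -/
  | ulcorner
  /-- `⌝`: from the bend point, the arms go left and down. -/
  | urcorner

namespace Shape

/-- Unit vector along the horizontal arm, seen from the bend point. -/
def hArm : Shape → ℤ × ℤ
  | llcorner => (1, 0)
  | lrcorner => (-1, 0)
  | ulcorner => (1, 0)
  | urcorner => (-1, 0)

/-- Unit vector along the vertical arm, seen from the bend point. -/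
def vArm : Shape → ℤ × ℤ
  | llcorner => (0, 1)
  | lrcorner => (0, 1)
  | ulcorner => (0, -1)
  | urcorner => (0, -1)

end Shape

namespace GridPath

/-- The path has exactly one bend, its bend point is `q`, and it has the shape `s` there. -/
def BendsAt (P : GridPath) (s : Shape) (q : ℤ × ℤ) : Prop :=
  P.numBends = 1 ∧ ∃ i, P.IsBend i ∧ P.pt (i + 1) = q ∧
    ({P.pt i, P.pt (i + 2)} : Set (ℤ × ℤ)) = {q + s.hArm, q + s.vArm}

/-- The path is a single bend path of shape `s`; a path without bends counts as a degenerate `⌞`. -/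
def HasShape (P : GridPath) (s : Shape) : Prop :=
  (P.numBends = 0 ∧ s = Shape.llcorner) ∨ ∃ q, P.BendsAt s q

end GridPath

/-- `P` is an EPG representation of `G`: distinct vertices are adjacent iff their paths share an
edge of the grid. -/
def IsEPGRep {V : Type*} (G : SimpleGraph V) (P : V → GridPath) : Prop :=
  ∀ u v, u ≠ v → (G.Adj u v ↔ (P u).Intersects (P v))

/-- `P` is a `B_k`-EPG representation of `G`. -/
def IsBEPGRep (k : ℕ) {V : Type*} (G : SimpleGraph V) (P : V → GridPath) : Prop :=
  IsEPGRep G P ∧ ∀ v, (P v).numBends ≤ k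

/-- The Helly property of a family of paths (as sets of grid edges): every pairwise intersecting
subfamily has a common edge. -/
def IsHelly {V : Type*} (P : V → GridPath) : Prop :=
  ∀ A : Set V, (∀ u ∈ A, ∀ v ∈ A, (P u).Intersects (P v)) → ∃ e ∈ grid.edgeSet, ∀ u ∈ A, e ∈ (P u).edgeSet

/-- Finite simple graphs. -/
structure FinGraph where
  V : Type
  [finite : Finite V]
  graph : SimpleGraph V

/-- The class of Helly-`B_k` EPG graphs. -/
def HellyBEPG (k : ℕ) : Set FinGraph :=
  {G | ∃ P : G.V → GridPath, IsBEPGRep k G.graph P ∧ IsHelly P}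

/-- The class `[S]` of graphs having a single bend representation in which the shapes of all
paths belong to `S`. -/
def shapeClass (S : Set Shape) : Set FinGraph :=
  {G | ∃ P : G.V → GridPath, IsBEPGRep 1 G.graph P ∧ ∀ v, ∃ s ∈ S, (P v).HasShape s}

/-- Four paths form a square-frame: they bend at the bottom-left, bottom-right, top-left and
top-right corner of a rectangle, with the shapes `⌞`, `⌟`, `⌜`, `⌝` respectively, paths at corners
that span a side of the rectangle intersect, and paths at opposite corners do not. -/
def IsSquareFrame (P₁ P₂ P₃ P₄ : GridPath) : Prop :=
  (∃ x₁ x₂ y₁ y₂ : ℤ, x₁ < x₂ ∧ y₁ < y₂ ∧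
    P₁.BendsAt Shape.llcorner (x₁, y₁) ∧ P₂.BendsAt Shape.lrcorner (x₂, y₁) ∧
    P₃.BendsAt Shape.ulcorner (x₁, y₂) ∧ P₄.BendsAt Shape.urcorner (x₂, y₂)) ∧
  P₁.Intersects P₂ ∧ P₁.Intersects P₃ ∧ P₂.Intersects P₄ ∧ P₃.Intersects P₄ ∧
  ¬ P₁.Intersects P₄ ∧ ¬ P₂.Intersects P₃

/-- The bat graph: four disjoint copies of `K_{2,4}` (the `i`-th one on the vertices `(i, a)`),
with one vertex `(i, inr 0)` of the larger part of each being a vertex of a `C₄`. -/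
def batGraph : SimpleGraph (Fin 4 × (Fin 2 ⊕ Fin 4)) where
  Adj p q := (p.1 = q.1 ∧ (completeBipartiteGraph (Fin 2) (Fin 4)).Adj p.2 q.2) ∨
    (p.2 = Sum.inr 0 ∧ q.2 = Sum.inr 0 ∧ (SimpleGraph.cycleGraph 4).Adj p.1 q.1)
  symm := ⟨fun p q h => by
    rcases h with ⟨h1, h2⟩ | ⟨h1, h2, h3⟩
    · exact Or.inl ⟨h1.symm, h2.symm⟩
    · exact Or.inr ⟨h2, h1, h3.symm⟩⟩
  loopless := ⟨fun p h => by
    rcases h with ⟨_, h⟩ | ⟨_, _, h⟩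
    · exact h.ne rfl
    · exact h.ne rfl⟩

/-- The 3-sun `S₃`: a triangle `inl 0, inl 1, inl 2` and three further, pairwise nonadjacent
vertices `inr j`, where `inr j` is adjacent to the two triangle vertices other than `inl j`. -/
def threeSun : SimpleGraph (Fin 3 ⊕ Fin 3) where
  Adj
    | Sum.inl i, Sum.inl j => i ≠ j
    | Sum.inl i, Sum.inr j => i ≠ j
    | Sum.inr i, Sum.inl j => i ≠ j
    | Sum.inr _, Sum.inr _ => False
  symm := ⟨fun p q h => by
    rcases p with i | i <;> rcases q with j | j
    · exact Ne.symm h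
    · exact Ne.symm h
    · exact Ne.symm h
    · exact h⟩
  loopless := ⟨fun p h => by
    rcases p with i | i
    · exact h rfl
    · exact h⟩

/-!
A path with at most one bend is determined by a few integers: the row and the interval of its
horizontal arm, the column and the interval of its vertical arm, and the fact that the two arms
share an endpoint. Such data is called a `Hook`. Every path with at most one bend traces a hook
(`GridPath.exists_traces`) and every hook is traced by a path (`GridPath.exists_path_traces`), so
that all claims become statements of linear integer arithmetic about hooks.

*Rigidity of `K_{2,4}`* (`Hook.crossed_or_crossed`). Let `a`, `b` be the disjoint paths of the
smaller side. A path that meets both does so in one of four ways: both in a column, both in a row,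
or one in a column and the other in a row. The first two ways occur at most once each, and once one
of them occurs there is no room for three further disjoint paths. The other two fix the bend point
and occur at most twice each; two paths of the same kind leave the bend point in opposite
directions. Hence each of the four paths bends at a point all of whose edges belong to `a` or `b`.
In particular at most one path at each of the two bend points has the shape `⌞`, so `K_{2,4}` is not
in `[⌞]`, while it is easily seen to be in `[⌞,⌝]`.

*The bat graph* (`exists_perm_isFrame_batGraph`). By rigidity, no other path of the `4`-cycle
touches the bend of a path of the `4`-cycle. So adjacent paths of the cycle have arms that point
towards each other in one row or one column, and since opposite paths are disjoint, rows and columns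
alternate around the cycle: the four bends are the corners of a rectangle. A square-frame uses all
four shapes, so the graph belongs to no class that omits `⌟`. It has no triangles, so every
representation is Helly.

*Helly representations* (`isHelly_of_isDiagonal`). Three pairwise intersecting paths without a
common edge include two with the same bend point and exactly one common direction there, and one of
these two has the shape `⌟` or `⌜`. With `⌞` and `⌝` only, pairwise intersecting paths therefore
intersect pairwise in one row or pairwise in one column, and intervals have the Helly property.

*The `3`-sun* (`Hook.not_sun`). In a Helly representation the paths of the triangle share an edge.
Two of the three further paths bend on the same side of it, and on one side the triangle looks like
a tree of paths rooted at the edge. Both further paths would have to pass through the point where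
the three branches separate, and would share the first edge of the branch that they both meet
(`Hook.right_side`).
-/

/-! ### Hooks -/

/-- The trace of a grid path with at most one bend, recorded by integers: the horizontal segment
from `(l, y)` to `(r, y)` and the vertical segment from `(x, d)` to `(x, u)`, which share the
endpoint `(x, y)`. One of the two segments may be trivial; the path is then straight, and `(x, y)`
is either of its endpoints. -/
structure Hook where
  x : ℤ
  y : ℤ
  l : ℤ
  r : ℤ
  d : ℤ
  u : ℤ
  hx : l ≤ r ∧ (x = l ∨ x = r)
  hy : d ≤ u ∧ (y = d ∨ y = u)
  pos : l < r ∨ d < u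

namespace Hook

/-- The hook contains the horizontal edge from `(i, j)` to `(i + 1, j)`. -/
def HasH (e : Hook) (i j : ℤ) : Prop := j = e.y ∧ e.l ≤ i ∧ i < e.r

/-- The hook contains the vertical edge from `(i, j)` to `(i, j + 1)`. -/
def HasV (e : Hook) (i j : ℤ) : Prop := i = e.x ∧ e.d ≤ j ∧ j < e.u

/-- The horizontal segments of two hooks share a grid edge. -/
def MeetsH (e f : Hook) : Prop :=
  e.y = f.y ∧ e.l < e.r ∧ f.l < f.r ∧ e.l < f.r ∧ f.l < e.r

/-- The vertical segments of two hooks share a grid edge. -/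
def MeetsV (e f : Hook) : Prop :=
  e.x = f.x ∧ e.d < e.u ∧ f.d < f.u ∧ e.d < f.u ∧ f.d < e.u

/-- Two hooks share a grid edge. -/
def Meets (e f : Hook) : Prop := e.MeetsH f ∨ e.MeetsV f

instance (e f : Hook) : Decidable (e.Meets f) := by
  unfold Meets MeetsH MeetsV; infer_instance

/-- Both segments of the hook are nontrivial, so that it has a bend. -/
def Bent (e : Hook) : Prop := e.l < e.r ∧ e.d < e.u

instance (e : Hook) : Decidable e.Bent := by unfold Bent; infer_instance

/-- The bend point is the endpoint of the two segments required by the shape. This determines the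
shape of a bent hook only; a trivial segment has its endpoints equal and fits either direction. -/
def ShapeIs (e : Hook) : Shape → Prop
  | .llcorner => e.x = e.l ∧ e.y = e.d
  | .lrcorner => e.x = e.r ∧ e.y = e.d
  | .ulcorner => e.x = e.l ∧ e.y = e.u
  | .urcorner => e.x = e.r ∧ e.y = e.u

instance (e : Hook) (s : Shape) : Decidable (e.ShapeIs s) := by
  cases s <;> unfold ShapeIs <;> infer_instance

/-- The reflection of a hook in the diagonal `x = y`. -/
def swap (e : Hook) : Hook :=
  ⟨e.y, e.x, e.d, e.u, e.l, e.r, e.hy, e.hx, e.pos.symm⟩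

/-- The reflection of a hook in the vertical axis. -/
def mirror (e : Hook) : Hook :=
  ⟨-e.x, e.y, -e.r, -e.l, e.d, e.u,
    ⟨by have := e.hx; omega, by have := e.hx; omega⟩, e.hy, by have := e.pos; omega⟩

theorem Meets.symm {e f : Hook} (h : e.Meets f) : f.Meets e := by
  unfold Meets MeetsH MeetsV at *; omega

theorem swap_meets_swap {e f : Hook} : e.swap.Meets f.swap ↔ e.Meets f := Or.comm

theorem mirror_meets_mirror {e f : Hook} : e.mirror.Meets f.mirror ↔ e.Meets f := by
  simp only [Meets, MeetsH, MeetsV, mirror]; omega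

theorem meets_iff_exists (e f : Hook) : e.Meets f ↔
    ∃ i j, (e.HasH i j ∧ f.HasH i j) ∨ (e.HasV i j ∧ f.HasV i j) := by
  unfold Meets MeetsH MeetsV HasH HasV
  constructor
  · rintro (h | h)
    · exact ⟨max e.l f.l, e.y, Or.inl (by omega)⟩
    · exact ⟨e.x, max e.d f.d, Or.inr (by omega)⟩
  · rintro ⟨i, j, h⟩
    omega

/-- The hook with bend point `(x, y)` whose arms have the signed lengths `a` and `b`: to the right
if `a` is positive and to the left if it is negative, up if `b` is positive and down if it is
negative. -/
def ofArms (x y a b : ℤ) (h : a ≠ 0 ∨ b ≠ 0) : Hook where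
  x := x
  y := y
  l := min x (x + a)
  r := max x (x + a)
  d := min y (y + b)
  u := max y (y + b)
  hx := by omega
  hy := by omega
  pos := by omega

theorem exists_eq_ofArms (e : Hook) : ∃ a b h, e = ofArms e.x e.y a b h := by
  obtain ⟨x, y, l, r, d, u, hx, hy, pos⟩ := e
  refine ⟨l + r - 2 * x, d + u - 2 * y, by omega, ?_⟩
  simp only [ofArms, Hook.mk.injEq, true_and]
  omega

/-! ### Hooks representing `K_{2,4}` -/

section K24

/-- The point `(i, j)` is an interior point of the horizontal segment. -/
def PassesH (e : Hook) (i j : ℤ) : Prop := e.y = j ∧ e.l < i ∧ i < e.r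

/-- The point `(i, j)` is an interior point of the vertical segment. -/
def PassesV (e : Hook) (i j : ℤ) : Prop := e.x = i ∧ e.d < j ∧ j < e.u

/-- `c` bends at a point where `a` passes vertically and `b` passes horizontally, so that all four
grid edges at the bend of `c` belong to `a` or `b`. -/
def Crossed (c a b : Hook) : Prop :=
  c.Bent ∧ a.PassesV c.x c.y ∧ b.PassesH c.x c.y

variable {a b c c' c'' : Hook}

/-- Both hooks bend where the column of `a` meets the row of `b`. Being disjoint, they leave that
point in opposite directions, and so `a` and `b` extend to both sides of it. -/
theorem crossed_of_vh (h : ¬ c.Meets c') (hv : c.MeetsV a) (hh : c.MeetsH b)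
    (hv' : c'.MeetsV a) (hh' : c'.MeetsH b) : c.Crossed a b := by
  have := c.hx; have := c.hy; have := c'.hx; have := c'.hy
  simp only [Meets, MeetsH, MeetsV, Crossed, Bent, PassesV, PassesH] at *
  omega

/-- Each of the three hooks bends at the same point, and two of them leave it in the same vertical
direction. -/
theorem not_three_vh (h : ¬ c.Meets c') (h' : ¬ c.Meets c'') (h'' : ¬ c'.Meets c'')
    (hv : c.MeetsV a) (hh : c.MeetsH b) (hv' : c'.MeetsV a) (hh' : c'.MeetsH b)
    (hv'' : c''.MeetsV a) (hh'' : c''.MeetsH b) : False := by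
  have := c.hx; have := c.hy; have := c'.hx; have := c'.hy; have := c''.hx; have := c''.hy
  simp only [Meets, MeetsH, MeetsV] at *
  omega

/-- A hook that meets two disjoint segments of one column contains the gap between them and an edge
on either side of it, so two such hooks share an edge. -/
theorem not_two_vv (hab : ¬ a.Meets b) (h : ¬ c.Meets c') (hv : c.MeetsV a) (hh : c.MeetsV b)
    (hv' : c'.MeetsV a) (hh' : c'.MeetsV b) : False := by
  simp only [Meets, MeetsH, MeetsV] at *
  omega

/-- By `crossed_of_vh`, the hook `b` would pass horizontally through a point of the column of `a`.
This is also the column of `b`, in which its horizontal segment ends. -/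
theorem not_vv_two_vh (h : ¬ c.Meets c')
    (hva : c''.MeetsV a) (hvb : c''.MeetsV b)
    (hv : c.MeetsV a) (hh : c.MeetsH b) (hv' : c'.MeetsV a) (hh' : c'.MeetsH b) : False := by
  have := crossed_of_vh h hv hh hv' hh'
  have := b.hx; have := b.hy
  simp only [Meets, MeetsH, MeetsV, Crossed, Bent, PassesV, PassesH] at *
  omega

/-- Here `a` and `b` lie in the same row and the same column, so they bend at the same point, and
`c'` and `c''` pass straight through it; the hook `c`, which bends there, shares an edge with
each. -/
theorem not_vv_hh_vh (hab : ¬ a.Meets b) (h : ¬ c.Meets c') (h' : ¬ c.Meets c'')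
    (hva : c'.MeetsV a) (hvb : c'.MeetsV b)
    (hv : c''.MeetsH a) (hh : c''.MeetsH b) (hv' : c.MeetsV a) (hh' : c.MeetsH b) : False := by
  have := a.hx; have := a.hy; have := b.hx; have := b.hy; have := c.hx; have := c.hy
  simp only [Meets, MeetsH, MeetsV] at *
  omega

theorem _root_.Fin.exists_ne_ne_of_four (i j : Fin 4) : ∃ k, k ≠ i ∧ k ≠ j := by
  revert i j; decide

theorem _root_.Fin.exists_others_of_four (i : Fin 4) : ∃ j k m, j ≠ i ∧ k ≠ i ∧ m ≠ i ∧
    j ≠ k ∧ j ≠ m ∧ k ≠ m := by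
  revert i; decide

theorem meets_cases (ha : c.Meets a) (hb : c.Meets b) :
    (c.MeetsV a ∧ c.MeetsV b) ∨ (c.MeetsH a ∧ c.MeetsH b) ∨
      (c.MeetsV a ∧ c.MeetsH b) ∨ (c.MeetsV b ∧ c.MeetsH a) := by
  unfold Meets at ha hb; tauto

/-- If `c i` met both `a` and `b` in a column, each of the other three hooks would be of one of the
remaining three types, the type meeting both in a row would be excluded, and two of the three would
be of the same type. -/
theorem not_vv (hab : ¬ a.Meets b) {c : Fin 4 → Hook} (hc : ∀ i j, i ≠ j → ¬ (c i).Meets (c j))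
    (ha : ∀ i, (c i).Meets a) (hb : ∀ i, (c i).Meets b) (i : Fin 4) :
    ¬ ((c i).MeetsV a ∧ (c i).MeetsV b) := by
  rintro ⟨hva, hvb⟩
  have hba : ¬ b.Meets a := fun h => hab h.symm
  have types : ∀ j, j ≠ i → ((c j).MeetsH a ∧ (c j).MeetsH b) ∨
      ((c j).MeetsV a ∧ (c j).MeetsH b) ∨ ((c j).MeetsV b ∧ (c j).MeetsH a) := fun j hj =>
    (meets_cases (ha j) (hb j)).resolve_left fun h =>
      not_two_vv hab (hc j i hj) h.1 h.2 hva hvb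
  have not_hh : ∀ j, j ≠ i → ¬ ((c j).MeetsH a ∧ (c j).MeetsH b) := by
    rintro j hj ⟨hha, hhb⟩
    obtain ⟨k, hki, hkj⟩ := Fin.exists_ne_ne_of_four i j
    rcases types k hki with h | h | h
    · exact not_two_vv (a := a.swap) (b := b.swap) (mt swap_meets_swap.1 hab)
        (mt swap_meets_swap.1 (hc k j hkj)) h.1 h.2 hha hhb
    · exact not_vv_hh_vh hab (hc k i hki) (hc k j hkj) hva hvb hha hhb h.1 h.2
    · exact not_vv_hh_vh hba (hc k i hki) (hc k j hkj) hvb hva hhb hha h.1 h.2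
  obtain ⟨j, k, m, hj, hk, hm, hjk, hjm, hkm⟩ := Fin.exists_others_of_four i
  have types' := fun j hj => (types j hj).resolve_left (not_hh j hj)
  -- two of the remaining three hooks are of the same type
  have vh : ∀ j k, j ≠ k → (c j).MeetsV a ∧ (c j).MeetsH b →
      ¬ ((c k).MeetsV a ∧ (c k).MeetsH b) := fun j k hjk h h' =>
    not_vv_two_vh (hc j k hjk) hva hvb h.1 h.2 h'.1 h'.2
  have hv : ∀ j k, j ≠ k → (c j).MeetsV b ∧ (c j).MeetsH a →
      ¬ ((c k).MeetsV b ∧ (c k).MeetsH a) := fun j k hjk h h' =>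
    not_vv_two_vh (hc j k hjk) hvb hva h.1 h.2 h'.1 h'.2
  rcases types' j hj with tj | tj
  · have tk := (types' k hk).resolve_left (vh j k hjk tj)
    exact hv k m hkm tk ((types' m hm).resolve_left (vh j m hjm tj))
  · have tk := (types' k hk).resolve_right (hv j k hjk tj)
    exact vh k m hkm tk ((types' m hm).resolve_right (hv j m hjm tj))

/-- Meeting both `a` and `b` in a row is excluded by reflecting `not_vv` in the diagonal. -/
theorem vh_or_hv (hab : ¬ a.Meets b) {c : Fin 4 → Hook}
    (hc : ∀ i j, i ≠ j → ¬ (c i).Meets (c j))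
    (ha : ∀ i, (c i).Meets a) (hb : ∀ i, (c i).Meets b) (i : Fin 4) :
    ((c i).MeetsV a ∧ (c i).MeetsH b) ∨ ((c i).MeetsV b ∧ (c i).MeetsH a) :=
  ((meets_cases (ha i) (hb i)).resolve_left (not_vv hab hc ha hb i)).resolve_left
    (not_vv (a := a.swap) (b := b.swap) (c := fun i => (c i).swap) (mt swap_meets_swap.1 hab)
      (fun i j h => mt swap_meets_swap.1 (hc i j h)) (fun i => swap_meets_swap.2 (ha i))
      (fun i => swap_meets_swap.2 (hb i)) i)

theorem crossed_of_vh_of_types {c : Fin 4 → Hook}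
    (hc : ∀ i j, i ≠ j → ¬ (c i).Meets (c j))
    (types : ∀ i, ((c i).MeetsV a ∧ (c i).MeetsH b) ∨ ((c i).MeetsV b ∧ (c i).MeetsH a))
    {i : Fin 4} (hi : (c i).MeetsV a ∧ (c i).MeetsH b) : (c i).Crossed a b := by
  obtain ⟨j, k, m, hj, hk, hm, hjk, hjm, hkm⟩ := Fin.exists_others_of_four i
  have vh : ∀ j, j ≠ i → (c j).MeetsV a ∧ (c j).MeetsH b → (c i).Crossed a b :=
    fun j hj h => crossed_of_vh (hc i j hj.symm) hi.1 hi.2 h.1 h.2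
  rcases types j with tj | tj
  · exact vh j hj tj
  rcases types k with tk | tk
  · exact vh k hk tk
  rcases types m with tm | tm
  · exact vh m hm tm
  exact (not_three_vh (hc j k hjk) (hc j m hjm) (hc k m hkm)
    tj.1 tj.2 tk.1 tk.2 tm.1 tm.2).elim

/-- In a representation of `K_{2,4}`, every path of the larger side bends at a point where one path
of the smaller side passes horizontally and the other one vertically. -/
theorem crossed_or_crossed (hab : ¬ a.Meets b) {c : Fin 4 → Hook}
    (hc : ∀ i j, i ≠ j → ¬ (c i).Meets (c j))
    (ha : ∀ i, (c i).Meets a) (hb : ∀ i, (c i).Meets b) (i : Fin 4) :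
    (c i).Crossed a b ∨ (c i).Crossed b a := by
  have types := vh_or_hv hab hc ha hb
  exact (types i).imp (crossed_of_vh_of_types hc types)
    (crossed_of_vh_of_types hc fun i => (types i).symm)

/-- The paths of the larger side bend at one of only two points, and two of them at the same point
must not both have the shape `⌞`. -/
theorem not_all_llcorner (hab : ¬ a.Meets b) {c : Fin 4 → Hook}
    (hc : ∀ i j, i ≠ j → ¬ (c i).Meets (c j))
    (ha : ∀ i, (c i).Meets a) (hb : ∀ i, (c i).Meets b)
    (hs : ∀ i, (c i).Bent → (c i).ShapeIs .llcorner) : False := by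
  have key : ∀ a b : Hook, ∀ i j, i ≠ j → (c i).Crossed a b → (c j).Crossed a b → False := by
    intro a b i j hij h h'
    have := hc i j hij
    have := hs i h.1
    have := hs j h'.1
    simp only [Meets, MeetsH, MeetsV, Crossed, Bent, PassesV, PassesH, ShapeIs] at *
    omega
  have cr := crossed_or_crossed hab hc ha hb
  -- two of the first three hooks are crossed in the same way
  rcases cr 0 with h0 | h0 <;> rcases cr 1 with h1 | h1 <;> rcases cr 2 with h2 | h2 <;>
  first
  | exact key _ _ _ _ (by decide) h0 h1
  | exact key _ _ _ _ (by decide) h0 h2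
  | exact key _ _ _ _ (by decide) h1 h2

end K24

/-! ### Hooks representing a `4`-cycle -/

section Frame

variable {a b c : Hook}

/-- No edge of the hook has the endpoint `(i, j)`. -/
def Avoids (e : Hook) (i j : ℤ) : Prop :=
  ¬ (e.y = j ∧ e.l < e.r ∧ e.l ≤ i ∧ i ≤ e.r) ∧ ¬ (e.x = i ∧ e.d < e.u ∧ e.d ≤ j ∧ j ≤ e.u)

theorem Crossed.avoids {f : Hook} (h : c.Crossed a b) (ha : ¬ f.Meets a) (hb : ¬ f.Meets b) :
    f.Avoids c.x c.y := by
  simp only [Meets, MeetsH, MeetsV, Crossed, Bent, PassesV, PassesH, Avoids] at *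
  constructor
  · intro hf
    exact hb (Or.inl (by omega))
  · intro hf
    exact ha (Or.inr (by omega))

/-- The hooks lie in the same row, `e` to the left of `f`; their horizontal arms point towards each
other and overlap, neither reaching the bend point of the other hook. -/
def FacesRight (e f : Hook) : Prop :=
  e.y = f.y ∧ e.x = e.l ∧ f.x = f.r ∧ e.l < f.l ∧ f.l < e.r ∧ e.r < f.r

/-- The horizontal arms of the two hooks point towards each other and overlap. -/
def FacesH (e f : Hook) : Prop := e.FacesRight f ∨ f.FacesRight e

/-- The vertical arms of the two hooks point towards each other and overlap. -/
def FacesV (e f : Hook) : Prop := e.swap.FacesH f.swap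

theorem FacesH.symm {e f : Hook} (h : e.FacesH f) : f.FacesH e := Or.symm h

theorem facesH_of_meetsH {e f : Hook} (h : e.MeetsH f)
    (h₁ : e.Avoids f.x f.y) (h₂ : f.Avoids e.x e.y) : e.FacesH f := by
  have := e.hx; have := f.hx
  obtain ⟨h₁, -⟩ := h₁
  obtain ⟨h₂, -⟩ := h₂
  simp only [MeetsH, FacesH, FacesRight] at *
  omega

theorem Avoids.swap {e : Hook} {i j : ℤ} (h : e.Avoids i j) : e.swap.Avoids j i := And.symm h

theorem facesH_or_facesV {e f : Hook} (h : e.Meets f)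
    (h₁ : e.Avoids f.x f.y) (h₂ : f.Avoids e.x e.y) : e.FacesH f ∨ e.FacesV f :=
  h.imp (fun h => facesH_of_meetsH h h₁ h₂)
    (fun h => facesH_of_meetsH (e := e.swap) (f := f.swap) h h₁.swap h₂.swap)

/-- The only horizontal arm of `e` points towards both hooks, which therefore come from the same
side and both contain the edge at its far end. -/
theorem FacesH.meets {e f g : Hook} (h : e.FacesH f) (h' : e.FacesH g) : f.Meets g := by
  simp only [Meets, MeetsH, FacesH, FacesRight] at *
  omega

theorem FacesV.meets {e f g : Hook} (h : e.FacesV f) (h' : e.FacesV g) : f.Meets g :=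
  swap_meets_swap.1 (FacesH.meets h h')

/-- The hooks have the corners and shapes of a square-frame, in the order bottom-left, bottom-right,
top-left, top-right. -/
def IsFrame (e₁ e₂ e₃ e₄ : Hook) : Prop :=
  (e₁.x < e₂.x ∧ e₁.y < e₃.y ∧ e₂.y = e₁.y ∧ e₃.x = e₁.x ∧ e₄.x = e₂.x ∧ e₄.y = e₃.y) ∧
  e₁.ShapeIs .llcorner ∧ e₂.ShapeIs .lrcorner ∧ e₃.ShapeIs .ulcorner ∧ e₄.ShapeIs .urcorner

theorem isFrame_of_faces {c : Fin 4 → Hook} (h₀₁ : (c 0).FacesH (c 1)) (h₁₂ : (c 1).FacesV (c 2))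
    (h₂₃ : (c 2).FacesH (c 3)) (h₃₀ : (c 3).FacesV (c 0)) :
    IsFrame (c 0) (c 1) (c 3) (c 2) ∨ IsFrame (c 1) (c 0) (c 2) (c 3) ∨
      IsFrame (c 3) (c 2) (c 0) (c 1) ∨ IsFrame (c 2) (c 3) (c 1) (c 0) := by
  rcases h₀₁ with h₀₁ | h₀₁ <;> rcases h₁₂ with h₁₂ | h₁₂ <;> rcases h₂₃ with h₂₃ | h₂₃ <;>
    rcases h₃₀ with h₃₀ | h₃₀ <;>
    simp only [FacesRight, swap, IsFrame, ShapeIs] at * <;>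
  first
  | (exfalso; omega)
  | (refine Or.inl ⟨⟨?_, ?_, ?_, ?_, ?_, ?_⟩, ⟨?_, ?_⟩, ⟨?_, ?_⟩, ⟨?_, ?_⟩, ?_, ?_⟩ <;> omega)
  | (refine Or.inr (Or.inl ⟨⟨?_, ?_, ?_, ?_, ?_, ?_⟩, ⟨?_, ?_⟩, ⟨?_, ?_⟩, ⟨?_, ?_⟩, ?_, ?_⟩) <;>
      omega)
  | (refine Or.inr (Or.inr (Or.inl
      ⟨⟨?_, ?_, ?_, ?_, ?_, ?_⟩, ⟨?_, ?_⟩, ⟨?_, ?_⟩, ⟨?_, ?_⟩, ?_, ?_⟩)) <;> omega)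
  | (refine Or.inr (Or.inr (Or.inr
      ⟨⟨?_, ?_, ?_, ?_, ?_, ?_⟩, ⟨?_, ?_⟩, ⟨?_, ?_⟩, ⟨?_, ?_⟩, ?_, ?_⟩)) <;> omega)

/-- Opposite hooks do not meet, so consecutive contacts along the cycle alternate between horizontal
and vertical ones. -/
theorem faces_alternate {c : Fin 4 → Hook}
    (hf : ∀ i, (c i).FacesH (c (i + 1)) ∨ (c i).FacesV (c (i + 1)))
    (hn : ∀ i, ¬ (c i).Meets (c (i + 2))) :
    ((c 0).FacesH (c 1) ∧ (c 1).FacesV (c 2) ∧ (c 2).FacesH (c 3) ∧ (c 3).FacesV (c 0)) ∨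
      ((c 1).FacesH (c 2) ∧ (c 2).FacesV (c 3) ∧ (c 3).FacesH (c 0) ∧ (c 0).FacesV (c 1)) := by
  have hh : ∀ i, (c i).FacesH (c (i + 1)) → ¬ (c (i + 1)).FacesH (c (i + 2)) :=
    fun i h h' => hn i (FacesH.meets h.symm h')
  have vv : ∀ i, (c i).FacesV (c (i + 1)) → ¬ (c (i + 1)).FacesV (c (i + 2)) :=
    fun i h h' => hn i (FacesV.meets (FacesH.symm h) h')
  rcases hf 0 with h₀ | h₀
  · have h₁ := (hf 1).resolve_left (hh 0 h₀)
    have h₂ := (hf 2).resolve_right (vv 1 h₁)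
    exact Or.inl ⟨h₀, h₁, h₂, (hf 3).resolve_left (hh 2 h₂)⟩
  · have h₁ := (hf 1).resolve_right (vv 0 h₀)
    have h₂ := (hf 2).resolve_left (hh 1 h₁)
    exact Or.inr ⟨h₁, h₂, (hf 3).resolve_right (vv 2 h₂), h₀⟩

/-- A representation of a `4`-cycle in which no path touches the bend of another one is a frame. -/
theorem exists_perm_isFrame {c : Fin 4 → Hook}
    (hm : ∀ i, (c i).Meets (c (i + 1))) (hn : ∀ i, ¬ (c i).Meets (c (i + 2)))
    (ha : ∀ i j, i ≠ j → (c j).Avoids (c i).x (c i).y) :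
    ∃ σ : Equiv.Perm (Fin 4), IsFrame (c (σ 0)) (c (σ 1)) (c (σ 2)) (c (σ 3)) ∧
      (σ 1 = σ 0 + 1 ∨ σ 0 = σ 1 + 1) ∧ (σ 2 = σ 0 + 1 ∨ σ 0 = σ 2 + 1) ∧
      (σ 3 = σ 1 + 1 ∨ σ 1 = σ 3 + 1) ∧ (σ 3 = σ 2 + 1 ∨ σ 2 = σ 3 + 1) ∧
      σ 3 = σ 0 + 2 ∧ σ 2 = σ 1 + 2 := by
  have hf : ∀ i, (c i).FacesH (c (i + 1)) ∨ (c i).FacesV (c (i + 1)) := fun i =>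
    facesH_or_facesV (hm i) (ha _ _ (by clear hm hn ha; revert i; decide))
      (ha _ _ (by clear hm hn ha; revert i; decide))
  rcases faces_alternate hf hn with ⟨h₁, h₂, h₃, h₄⟩ | ⟨h₁, h₂, h₃, h₄⟩
  · rcases isFrame_of_faces h₁ h₂ h₃ h₄ with h | h | h | h
    · exact ⟨⟨![0, 1, 3, 2], ![0, 1, 3, 2], by decide, by decide⟩, h, by decide⟩
    · exact ⟨⟨![1, 0, 2, 3], ![1, 0, 2, 3], by decide, by decide⟩, h, by decide⟩
    · exact ⟨⟨![3, 2, 0, 1], ![2, 3, 1, 0], by decide, by decide⟩, h, by decide⟩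
    · exact ⟨⟨![2, 3, 1, 0], ![3, 2, 0, 1], by decide, by decide⟩, h, by decide⟩
  · rcases isFrame_of_faces (c := fun i => c (i + 1)) h₁ h₂ h₃ h₄ with h | h | h | h
    · exact ⟨⟨![1, 2, 0, 3], ![2, 0, 1, 3], by decide, by decide⟩, h, by decide⟩
    · exact ⟨⟨![2, 1, 3, 0], ![3, 1, 0, 2], by decide, by decide⟩, h, by decide⟩
    · exact ⟨⟨![0, 3, 1, 2], ![0, 2, 3, 1], by decide, by decide⟩, h, by decide⟩
    · exact ⟨⟨![3, 0, 2, 1], ![1, 3, 2, 0], by decide, by decide⟩, h, by decide⟩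

end Frame

/-! ### Pairwise meeting hooks of shapes `⌞` and `⌝` -/

/-- The hook is straight or has the shape `⌞` or `⌝`. -/
def IsDiagonal (e : Hook) : Prop := e.Bent → e.ShapeIs .llcorner ∨ e.ShapeIs .urcorner

theorem IsDiagonal.swap {e : Hook} (h : e.IsDiagonal) : e.swap.IsDiagonal := by
  simp only [IsDiagonal, Hook.swap, Bent, ShapeIs] at *
  omega

/-- If `r` and `s` did not meet vertically, they would bend at the same point with the same
horizontal and opposite vertical directions, which the shapes `⌞` and `⌝` exclude. -/
theorem meetsV_of_meetsV {p r s : Hook} (hr : r.IsDiagonal) (hs : s.IsDiagonal)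
    (hpr : p.MeetsV r) (hps : p.MeetsV s) (hrs : r.Meets s) : r.MeetsV s := by
  have := r.hx; have := s.hx
  simp only [IsDiagonal, Bent, ShapeIs, Meets, MeetsH, MeetsV] at *
  omega

theorem meetsH_of_meetsH {p r s : Hook} (hr : r.IsDiagonal) (hs : s.IsDiagonal)
    (hpr : p.MeetsH r) (hps : p.MeetsH s) (hrs : r.Meets s) : r.MeetsH s :=
  meetsV_of_meetsV hr.swap hs.swap (p := p.swap) hpr hps (swap_meets_swap.2 hrs)

theorem MeetsV.symm {e f : Hook} (h : e.MeetsV f) : f.MeetsV e := by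
  unfold MeetsV at *; omega

theorem forall_meetsH_or_forall_meetsV {ι : Type*} {e : ι → Hook} (hd : ∀ i, (e i).IsDiagonal)
    {A : Set ι} (hA : ∀ i ∈ A, ∀ j ∈ A, (e i).Meets (e j)) :
    (∀ i ∈ A, ∀ j ∈ A, (e i).MeetsH (e j)) ∨ (∀ i ∈ A, ∀ j ∈ A, (e i).MeetsV (e j)) := by
  by_contra! ⟨⟨p, hp, q, hq, hpq⟩, r, hr, s, hs, hrs⟩
  have hpq' : (e p).MeetsV (e q) := (hA p hp q hq).resolve_left hpq
  have key : ∀ i ∈ A, (e p).MeetsV (e i) := by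
    intro i hi
    by_contra h
    have h' : (e p).MeetsH (e i) := (hA p hp i hi).resolve_right h
    rcases hA q hq i hi with h₂ | h₂
    · refine hpq (meetsH_of_meetsH (hd p) (hd q) (p := e i) ?_ ?_ (hA p hp q hq))
      · unfold MeetsH at *; omega
      · unfold MeetsH at *; omega
    · exact h (meetsV_of_meetsV (hd p) (hd i) hpq'.symm h₂ (hA p hp i hi))
  exact hrs (meetsV_of_meetsV (hd r) (hd s) (key r hr) (key s hs) (hA r hr s hs))

/-- The Helly property of intervals: the edge above the highest lower end is common to all. -/
theorem exists_common_hasV {ι : Type*} [Finite ι] {e : ι → Hook} {A : Set ι} (hne : A.Nonempty)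
    (hA : ∀ i ∈ A, ∀ j ∈ A, (e i).MeetsV (e j)) : ∃ x t, ∀ i ∈ A, (e i).HasV x t := by
  obtain ⟨p, hp, hmax⟩ := Set.exists_max_image A (fun i => (e i).d) A.toFinite hne
  refine ⟨(e p).x, (e p).d, fun i hi => ?_⟩
  have h := hA p hp i hi
  have := hmax i hi
  unfold MeetsV at h
  unfold HasV
  omega

/-! ### Hooks representing a `3`-sun -/

section Sun

variable {a b : Hook}

/-- For a hook `b` that avoids the edge and whose bend point lies to its right, meeting `a` concerns
only the part of `a` to the right of the edge. -/
theorem meets_right_iff {t y : ℤ} (ha : a.HasH t y) (hb : ¬ b.HasH t y) (hx : t < b.x) :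
    b.Meets a ↔ (b.y = y ∧ t < b.l ∧ b.l < b.r ∧ b.l < a.r) ∨
      (a.x = a.r ∧ b.x = a.r ∧ b.d < b.u ∧ a.d < a.u ∧ b.d < a.u ∧ a.d < b.u) := by
  have := a.hx; have := b.hx
  simp only [Meets, MeetsH, MeetsV, HasH] at *
  omega

theorem not_hasH_of_not_meets {t y : ℤ} (ha : a.HasH t y) (h : ¬ b.Meets a) : ¬ b.HasH t y := by
  simp only [Meets, MeetsH, HasH] at *
  omega

/-- Three hooks through a common horizontal edge form a tree to the right of it, rooted at the edge.
Two disjoint hooks `b₀` and `b₁` there, `b₀` meeting all but `a₀` and `b₁` all but `a₁`, would both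
have to pass through the point where `a₀`, `a₁` and `a₂` separate, and both would use the first edge
of `a₂` beyond it. -/
theorem right_side {a₀ a₁ a₂ b₀ b₁ : Hook} {t y : ℤ}
    (h₀ : a₀.HasH t y) (h₁ : a₁.HasH t y) (h₂ : a₂.HasH t y) (hb₀ : t < b₀.x) (hb₁ : t < b₁.x)
    (h00 : ¬ b₀.Meets a₀) (h01 : b₀.Meets a₁) (h02 : b₀.Meets a₂)
    (h10 : b₁.Meets a₀) (h11 : ¬ b₁.Meets a₁) (h12 : b₁.Meets a₂) (hb : ¬ b₀.Meets b₁) :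
    False := by
  have n₀ := not_hasH_of_not_meets h₀ h00
  have n₁ := not_hasH_of_not_meets h₁ h11
  rw [meets_right_iff h₀ n₀ hb₀] at h00
  rw [meets_right_iff h₁ n₀ hb₀] at h01
  rw [meets_right_iff h₂ n₀ hb₀] at h02
  rw [meets_right_iff h₀ n₁ hb₁] at h10
  rw [meets_right_iff h₁ n₁ hb₁] at h11
  rw [meets_right_iff h₂ n₁ hb₁] at h12
  simp only [Meets, MeetsH, MeetsV] at hb
  obtain ⟨rfl, -⟩ := h₀
  have e1 := h₁.1
  have e2 := h₂.1
  have hx₀ := b₀.hx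
  have hx₁ := b₁.hx
  clear h₁ h₂ n₀ n₁ hb₀ hb₁
  -- the cases are the ways, along the row or along a column, in which `b₀` meets `a₁` and `a₂` and
  -- `b₁` meets `a₀` and `a₂`; a row contact that is missing bounds the arm of `a₀` or `a₁`
  rcases h01 with h01 | h01
  · have q : a₀.r ≤ b₀.l := not_lt.mp fun h => h00 (.inl ⟨h01.1, h01.2.1, h01.2.2.1, h⟩)
    rcases h12 with h12 | h12
    · have q' : a₁.r ≤ b₁.l := not_lt.mp fun h => h11 (.inl ⟨h12.1, h12.2.1, h12.2.2.1, h⟩)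
      clear h02 h00 h11 hb
      omega
    · rcases h02 with h02 | h02 <;> rcases h10 with h10 | h10
      · clear h00 hb; omega
      · clear h00 hb; omega
      · have q' : a₁.r ≤ b₁.l := not_lt.mp fun h => h11 (.inl ⟨h10.1, h10.2.1, h10.2.2.1, h⟩)
        clear h00 hb; omega
      · have q' : ¬ _ := fun h => hb (.inr h)
        have q'' : ¬ _ := fun h => h00 (.inr h)
        have := a₀.hy; have := a₂.hy; have := b₀.hy
        clear h11 h00 hb
        omega
  · rcases h02 with h02 | h02 <;> rcases h10 with h10 | h10
    · have q : a₀.r ≤ b₀.l := not_lt.mp fun h => h00 (.inl ⟨h02.1, h02.2.1, h02.2.2.1, h⟩)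
      have q' : a₁.r ≤ b₁.l := not_lt.mp fun h => h11 (.inl ⟨h10.1, h10.2.1, h10.2.2.1, h⟩)
      clear h00 h11 h12 hb; omega
    · have q : a₀.r ≤ b₀.l := not_lt.mp fun h => h00 (.inl ⟨h02.1, h02.2.1, h02.2.2.1, h⟩)
      rcases h12 with h12 | h12
      · have q' : a₁.r ≤ b₁.l := not_lt.mp fun h => h11 (.inl ⟨h12.1, h12.2.1, h12.2.2.1, h⟩)
        clear h00 h11; omega
      · clear h00 h11 hb; omega
    · have q' : a₁.r ≤ b₁.l := not_lt.mp fun h => h11 (.inl ⟨h10.1, h10.2.1, h10.2.2.1, h⟩)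
      rcases h12 with h12 | h12
      · clear h00 h11 hb; omega
      · have p : ¬ _ := fun h => hb (.inr h)
        have p' : ¬ _ := fun h => h11 (.inr h)
        have := a₁.hy; have := a₂.hy; have := b₁.hy
        clear h00 h11 hb; omega
    · rcases h12 with h12 | h12
      · have q' : a₁.r ≤ b₁.l := not_lt.mp fun h => h11 (.inl ⟨h12.1, h12.2.1, h12.2.2.1, h⟩)
        clear h00 h11 hb; omega
      · have := a₀.hy; have := a₁.hy; have := a₂.hy
        have p : ¬ _ := fun h => hb (.inr h)
        have p' : ¬ _ := fun h => h00 (.inr h)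
        have p'' : ¬ _ := fun h => h11 (.inr h)
        clear h00 h11 hb; omega

theorem _root_.Fin.exists_ne_ne_of_three (i j : Fin 3) : ∃ k, i ≠ k ∧ j ≠ k := by
  revert i j; decide

theorem no_two_right {a b : Fin 3 → Hook} {t y : ℤ} (ha : ∀ i, (a i).HasH t y)
    (hab : ∀ i j, (b i).Meets (a j) ↔ i ≠ j) (hb : ∀ i j, i ≠ j → ¬ (b i).Meets (b j))
    {i j : Fin 3} (hij : i ≠ j) (hi : t < (b i).x) (hj : t < (b j).x) : False := by
  obtain ⟨k, hik, hjk⟩ := Fin.exists_ne_ne_of_three i j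
  refine right_side (ha i) (ha j) (ha k) hi hj ?_ ?_ ?_ ?_ ?_ ?_ (hb i j hij) <;> rw [hab] <;>
    tauto

theorem HasH.mirror {e : Hook} {t y : ℤ} (h : e.HasH t y) : e.mirror.HasH (-t - 1) y := by
  simp only [HasH, Hook.mirror] at *; omega

/-- Among three bend points, two lie on the same side of the common edge. -/
theorem not_sun {a b : Fin 3 → Hook} {t y : ℤ} (ha : ∀ i, (a i).HasH t y)
    (hab : ∀ i j, (b i).Meets (a j) ↔ i ≠ j) (hb : ∀ i j, i ≠ j → ¬ (b i).Meets (b j)) :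
    False := by
  have right : ∀ i j, i ≠ j → t < (b i).x → ¬ t < (b j).x := fun i j hij hi hj =>
    no_two_right ha hab hb hij hi hj
  have left : ∀ i j, i ≠ j → ¬ t < (b i).x → t < (b j).x := by
    intro i j hij hi
    by_contra hj
    refine no_two_right (a := fun i => (a i).mirror) (b := fun i => (b i).mirror)
      (t := -t - 1) (y := y) (fun i => (ha i).mirror)
      (fun i j => mirror_meets_mirror.trans (hab i j))
      (fun i j h => mt mirror_meets_mirror.1 (hb i j h)) hij ?_ ?_ <;>
    · simp only [Hook.mirror]; omega
  have := right 0 1 (by decide)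
  have := right 0 2 (by decide)
  have := right 1 2 (by decide)
  have := left 0 1 (by decide)
  have := left 0 2 (by decide)
  have := left 1 2 (by decide)
  tauto

end Sun

end Hook

/-! ### The edges and bends of a path -/

namespace GridPath

theorem grid_adj_iff (p q : ℤ × ℤ) : grid.Adj p q ↔
    (p.2 = q.2 ∧ (q.1 = p.1 + 1 ∨ p.1 = q.1 + 1)) ∨
      (p.1 = q.1 ∧ (q.2 = p.2 + 1 ∨ p.2 = q.2 + 1)) := by
  simp only [grid, abs_eq zero_le_one]
  omega

theorem adj_pt_succ (P : GridPath) {i : ℕ} (hi : i < P.walk.length) :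
    grid.Adj (P.pt i) (P.pt (i + 1)) :=
  P.walk.adj_getVert_succ hi

theorem pt_injOn (P : GridPath) {i j : ℕ} (hi : i ≤ P.walk.length) (hj : j ≤ P.walk.length)
    (h : P.pt i = P.pt j) : i = j :=
  P.isPath.getVert_injOn hi hj h

theorem mk_mem_edgeSet_iff (P : GridPath) (p q : ℤ × ℤ) :
    s(p, q) ∈ P.edgeSet ↔ ∃ i < P.walk.length, s(P.pt i, P.pt (i + 1)) = s(p, q) :=
  P.walk.mk_mem_edges_iff_exists

/-- The path contains the horizontal edge from `(i, j)` to `(i + 1, j)`. -/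
def HasH (P : GridPath) (i j : ℤ) : Prop := s((i, j), (i + 1, j)) ∈ P.edgeSet

/-- The path contains the vertical edge from `(i, j)` to `(i, j + 1)`. -/
def HasV (P : GridPath) (i j : ℤ) : Prop := s((i, j), (i, j + 1)) ∈ P.edgeSet

theorem hasH_iff (P : GridPath) (i j : ℤ) : P.HasH i j ↔ ∃ t < P.walk.length,
    (P.pt t).2 = j ∧ (P.pt (t + 1)).2 = j ∧
    ((P.pt t).1 = i ∧ (P.pt (t + 1)).1 = i + 1 ∨ (P.pt t).1 = i + 1 ∧ (P.pt (t + 1)).1 = i) := by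
  rw [HasH, mk_mem_edgeSet_iff]
  refine exists_congr fun t => and_congr_right fun _ => ?_
  rw [Sym2.eq_iff, Prod.ext_iff, Prod.ext_iff, Prod.ext_iff, Prod.ext_iff]
  tauto

theorem hasV_iff (P : GridPath) (i j : ℤ) : P.HasV i j ↔ ∃ t < P.walk.length,
    (P.pt t).1 = i ∧ (P.pt (t + 1)).1 = i ∧
    ((P.pt t).2 = j ∧ (P.pt (t + 1)).2 = j + 1 ∨ (P.pt t).2 = j + 1 ∧ (P.pt (t + 1)).2 = j) := by
  rw [HasV, mk_mem_edgeSet_iff]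
  refine exists_congr fun t => and_congr_right fun _ => ?_
  rw [Sym2.eq_iff, Prod.ext_iff, Prod.ext_iff, Prod.ext_iff, Prod.ext_iff]
  tauto

theorem edgeSet_subset (P : GridPath) : P.edgeSet ⊆ grid.edgeSet := fun _ h =>
  P.walk.edges_subset_edgeSet h

theorem mem_grid_edgeSet_iff (e : Sym2 (ℤ × ℤ)) : e ∈ grid.edgeSet ↔
    ∃ i j : ℤ, e = s((i, j), (i + 1, j)) ∨ e = s((i, j), (i, j + 1)) := by
  induction e with | _ p q
  obtain ⟨p₁, p₂⟩ := p
  obtain ⟨q₁, q₂⟩ := q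
  simp only [SimpleGraph.mem_edgeSet, grid_adj_iff, Sym2.eq_iff, Prod.mk.injEq]
  constructor
  · exact fun h => ⟨min p₁ q₁, min p₂ q₂, by omega⟩
  · rintro ⟨i, j, h⟩
    omega

theorem exists_edge_iff (p : Sym2 (ℤ × ℤ) → Prop) : (∃ e ∈ grid.edgeSet, p e) ↔
    ∃ i j : ℤ, p s((i, j), (i + 1, j)) ∨ p s((i, j), (i, j + 1)) := by
  constructor
  · rintro ⟨e, he, hp⟩
    obtain ⟨i, j, rfl | rfl⟩ := (mem_grid_edgeSet_iff e).1 he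
    · exact ⟨i, j, Or.inl hp⟩
    · exact ⟨i, j, Or.inr hp⟩
  · rintro ⟨i, j, h | h⟩
    · exact ⟨_, (mem_grid_edgeSet_iff _).2 ⟨i, j, Or.inl rfl⟩, h⟩
    · exact ⟨_, (mem_grid_edgeSet_iff _).2 ⟨i, j, Or.inr rfl⟩, h⟩

theorem intersects_iff (P Q : GridPath) : P.Intersects Q ↔
    ∃ i j, (P.HasH i j ∧ Q.HasH i j) ∨ (P.HasV i j ∧ Q.HasV i j) := by
  refine Iff.trans ?_ (exists_edge_iff fun e => e ∈ P.edgeSet ∧ e ∈ Q.edgeSet)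
  exact ⟨fun ⟨e, h⟩ => ⟨e, P.edgeSet_subset h.1, h⟩, fun ⟨e, _, h⟩ => ⟨e, h⟩⟩

/-- The path has the same edges, the same number of bends, and the same bend point and shape as the
hook. -/
structure Traces (P : GridPath) (e : Hook) : Prop where
  hasH_iff : ∀ i j, P.HasH i j ↔ e.HasH i j
  hasV_iff : ∀ i j, P.HasV i j ↔ e.HasV i j
  numBends_eq : P.numBends = if e.Bent then 1 else 0
  bendsAt_iff : ∀ s q, P.BendsAt s q ↔ e.Bent ∧ e.ShapeIs s ∧ q = (e.x, e.y)

section corner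

variable {P : GridPath} {x y ε δ : ℤ} {m k : ℕ}

theorem numBends_of_isBend_iff (hlen : P.walk.length = m + k)
    (h : ∀ i, P.IsBend i ↔ i + 1 = m ∧ 1 ≤ k) : P.numBends = if 1 ≤ m ∧ 1 ≤ k then 1 else 0 := by
  unfold numBends
  split_ifs with hmk
  · rw [Finset.card_eq_one]
    refine ⟨m - 1, ?_⟩
    ext i
    simp only [Finset.mem_filter, Finset.mem_range, h, Finset.mem_singleton]
    omega
  · rw [Finset.card_eq_zero, Finset.filter_eq_empty_iff]
    intro i _
    rw [h]
    omega

theorem bendsAt_iff_of_isBend_iff (hlen : P.walk.length = m + k)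
    (h : ∀ i, P.IsBend i ↔ i + 1 = m ∧ 1 ≤ k) {q : ℤ × ℤ} (hq : P.pt m = q)
    (hpt : 1 ≤ m → 1 ≤ k → ({P.pt (m - 1), P.pt (m + 1)} : Set (ℤ × ℤ)) =
      {(q.1 + ε, q.2), (q.1, q.2 + δ)}) (s : Shape) (q' : ℤ × ℤ) :
    P.BendsAt s q' ↔ (1 ≤ m ∧ 1 ≤ k) ∧ (s.hArm.1 = ε ∧ s.vArm.2 = δ) ∧ q' = q := by
  unfold BendsAt
  rw [numBends_of_isBend_iff hlen h]
  constructor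
  · rintro ⟨h₁, i, hi, rfl, h₃⟩
    have hmk : 1 ≤ m ∧ 1 ≤ k := by
      by_contra hmk
      simp [hmk] at h₁
    obtain ⟨rfl, -⟩ := (h i).1 hi
    have := hpt hmk.1 hmk.2
    rw [Nat.add_sub_cancel, h₃, hq] at this
    refine ⟨hmk, ?_, hq⟩
    rw [Set.pair_eq_pair_iff] at this
    obtain ⟨q₁, q₂⟩ := q
    cases s <;> simp [Shape.hArm, Shape.vArm] at this ⊢ <;> omega
  · rintro ⟨hmk, hs, rfl⟩
    obtain ⟨n, rfl⟩ : ∃ n, m = n + 1 := ⟨m - 1, by omega⟩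
    refine ⟨by simp [hmk], n, (h n).2 ⟨rfl, hmk.2⟩, hq, ?_⟩
    have := hpt hmk.1 hmk.2
    rw [Nat.add_sub_cancel] at this
    rw [this, ← hs.1, ← hs.2]
    obtain ⟨q₁, q₂⟩ := q'
    cases s <;> simp [Shape.hArm, Shape.vArm]

/-- A path that first walks `m` steps along the row to `(x, y)` and then `k` steps along the
column. -/
theorem traces_ofArms (hε : ε = 1 ∨ ε = -1) (hδ : δ = 1 ∨ δ = -1) (hlen : P.walk.length = m + k)
    (h₁ : ∀ i ≤ m, (P.pt i).1 = x + ε * (m - i) ∧ (P.pt i).2 = y)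
    (h₂ : ∀ i ≤ k, (P.pt (m + i)).1 = x ∧ (P.pt (m + i)).2 = y + δ * i)
    (h₀ : ε * (m : ℤ) ≠ 0 ∨ δ * (k : ℤ) ≠ 0) :
    P.Traces (Hook.ofArms x y (ε * m) (δ * k) h₀) := by
  have h₂' : ∀ i, m ≤ i → i ≤ m + k → (P.pt i).1 = x ∧ (P.pt i).2 = y + δ * (i - m) := by
    intro i hi hi'
    obtain ⟨j, rfl⟩ := Nat.exists_eq_add_of_le hi
    have := h₂ j (by omega)
    push_cast
    rwa [add_sub_cancel_left]
  have bend : ∀ i, P.IsBend i ↔ i + 1 = m ∧ 1 ≤ k := by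
    intro i
    unfold IsBend
    rw [hlen]
    rcases lt_trichotomy (i + 1) m with h | h | h
    · have a₀ := h₁ i (by omega)
      have a₁ := h₁ (i + 1) (by omega)
      have a₂ := h₁ (i + 2) (by omega)
      push_cast at *
      rcases hε with rfl | rfl <;> omega
    · have a₀ := h₁ i (by omega)
      have a₁ := h₁ (i + 1) (by omega)
      have a₂ := h₂' (i + 2) (by omega)
      push_cast at *
      rcases hε with rfl | rfl <;> omega
    · by_cases hk : i + 2 ≤ m + k
      · have a₀ := h₂' i (by omega) (by omega)
        have a₁ := h₂' (i + 1) (by omega) (by omega)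
        have a₂ := h₂' (i + 2) (by omega) hk
        omega
      · omega
  have hm := h₁ m le_rfl
  rw [sub_self, mul_zero, add_zero] at hm
  have hm : P.pt m = (x, y) := Prod.ext hm.1 hm.2
  constructor
  · intro i j
    rw [P.hasH_iff, Hook.HasH, hlen]
    constructor
    · rintro ⟨t, ht, h⟩
      rcases lt_or_ge t m with htm | htm
      · have a₀ := h₁ t (by omega)
        have a₁ := h₁ (t + 1) (by omega)
        push_cast at *
        simp only [Hook.ofArms]
        rcases hε with rfl | rfl <;> omega
      · have a₀ := h₂' t (by omega) (by omega)
        have a₁ := h₂' (t + 1) (by omega) (by omega)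
        omega
    · simp only [Hook.ofArms]
      rintro ⟨rfl, h⟩
      obtain ⟨t, ht, h'⟩ : ∃ t < m,
          x + ε * (m - t) = i ∧ ε = -1 ∨ x + ε * (m - t) = i + 1 ∧ ε = 1 := by
        rcases hε with rfl | rfl
        · exact ⟨(x + m - 1 - i).toNat, by omega, by omega⟩
        · exact ⟨(i - x + m).toNat, by omega, by omega⟩
      have a₀ := h₁ t (by omega)
      have a₁ := h₁ (t + 1) (by omega)
      refine ⟨t, by omega, a₀.2, a₁.2, ?_⟩
      push_cast at *
      rcases hε with rfl | rfl <;> omega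
  · intro i j
    rw [P.hasV_iff, Hook.HasV, hlen]
    constructor
    · rintro ⟨t, ht, h⟩
      rcases lt_or_ge t m with htm | htm
      · have a₀ := h₁ t (by omega)
        have a₁ := h₁ (t + 1) (by omega)
        omega
      · have a₀ := h₂' t (by omega) (by omega)
        have a₁ := h₂' (t + 1) (by omega) (by omega)
        push_cast at *
        simp only [Hook.ofArms]
        rcases hδ with rfl | rfl <;> omega
    · simp only [Hook.ofArms]
      rintro ⟨rfl, h⟩
      obtain ⟨t, ht, h'⟩ : ∃ t < k, y + δ * t = j ∧ δ = 1 ∨ y + δ * t = j + 1 ∧ δ = -1 := by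
        rcases hδ with rfl | rfl
        · exact ⟨(j - y).toNat, by omega, by omega⟩
        · exact ⟨(y - j - 1).toNat, by omega, by omega⟩
      have a₀ := h₂ t (by omega)
      have a₁ := h₂ (t + 1) (by omega)
      refine ⟨m + t, by omega, a₀.1, a₁.1, ?_⟩
      rw [add_assoc]
      push_cast at *
      rcases hδ with rfl | rfl <;> omega
  · rw [numBends_of_isBend_iff hlen bend]
    have : (1 ≤ m ∧ 1 ≤ k) ↔ (Hook.ofArms x y (ε * m) (δ * k) h₀).Bent := by
      simp only [Hook.Bent, Hook.ofArms, min_lt_max]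
      refine and_congr ?_ ?_
      · rcases hε with rfl | rfl <;> omega
      · rcases hδ with rfl | rfl <;> omega
    exact if_congr this rfl rfl
  · intro s q
    rw [bendsAt_iff_of_isBend_iff (ε := ε) (δ := δ) hlen bend hm]
    · refine and_assoc.symm.trans (Iff.trans (and_congr_left fun _ => ?_) and_assoc)
      simp only [Hook.Bent, Hook.ofArms, min_lt_max]
      rcases hε with rfl | rfl <;> rcases hδ with rfl | rfl <;> cases s <;>
        simp only [Shape.hArm, Shape.vArm, Hook.ShapeIs, true_and, and_true] <;> omega
    · intro hm' hk
      have a₀ := h₁ (m - 1) (by omega)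
      have a₂ := h₂ 1 (by omega)
      congr 1
      · refine Prod.ext ?_ a₀.2
        rw [a₀.1]
        push_cast [hm']
        ring
      · rw [Set.singleton_eq_singleton_iff]
        refine Prod.ext a₂.1 ?_
        rw [a₂.2]
        push_cast
        ring

end corner
end GridPath

/-! ### Paths with at most one bend and hooks -/

/-- A sequence with steps `±1` that never steps back is monotone of constant slope. -/
theorem Int.exists_eq_add_mul_of_steps {f : ℕ → ℤ} {n : ℕ}
    (h₁ : ∀ i < n, f (i + 1) = f i + 1 ∨ f i = f (i + 1) + 1)
    (h₂ : ∀ i, i + 2 ≤ n → f (i + 2) ≠ f i) :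
    ∃ ε : ℤ, (ε = 1 ∨ ε = -1) ∧ ∀ i ≤ n, f i = f 0 + ε * i := by
  rcases n.eq_zero_or_pos with rfl | hn
  · exact ⟨1, Or.inl rfl, fun i hi => by obtain rfl := Nat.le_zero.1 hi; simp⟩
  refine ⟨f 1 - f 0, by have := h₁ 0 hn; rw [zero_add] at this; omega, ?_⟩
  have step : ∀ i < n, f (i + 1) - f i = f 1 - f 0 := by
    intro i
    induction i with
    | zero => simp
    | succ i ih =>
      intro hi
      have := ih (by omega)
      have := h₁ i (by omega)
      have := h₁ (i + 1) hi
      have := h₂ i hi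
      rw [add_assoc, one_add_one_eq_two] at *
      omega
  intro i
  induction i with
  | zero => simp
  | succ i ih =>
    intro hi
    have := step i (by omega)
    have := ih (by omega)
    push_cast
    linarith

namespace GridPath

/-- The path traversed from its target to its source. -/
def reverse (P : GridPath) : GridPath :=
  ⟨P.target, P.source, P.walk.reverse, P.isPath.reverse, by
    rw [SimpleGraph.Walk.length_reverse]; exact P.length_pos⟩

theorem length_reverse (P : GridPath) : P.reverse.walk.length = P.walk.length :=
  P.walk.length_reverse

theorem pt_reverse (P : GridPath) (i : ℕ) : P.reverse.pt i = P.pt (P.walk.length - i) :=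
  P.walk.getVert_reverse i

theorem reverse_reverse (P : GridPath) : P.reverse.reverse = P := by
  simp [reverse]

theorem edgeSet_reverse (P : GridPath) : P.reverse.edgeSet = P.edgeSet := by
  simp [edgeSet, reverse]

theorem IsBend.reverse {P : GridPath} {i : ℕ} (h : P.IsBend i) :
    P.reverse.IsBend (P.walk.length - 2 - i) := by
  obtain ⟨hi, h⟩ := h
  refine ⟨by rw [length_reverse]; omega, ?_⟩
  simp only [pt_reverse]
  rw [show P.walk.length - (P.walk.length - 2 - i) = i + 2 by omega,
    show P.walk.length - (P.walk.length - 2 - i + 1) = i + 1 by omega,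
    show P.walk.length - (P.walk.length - 2 - i + 2) = i by omega]
  exact fun h' => h ⟨fun a => (h'.2 a.symm).symm, fun a => (h'.1 a.symm).symm⟩

theorem numBends_reverse_le (P : GridPath) : P.numBends ≤ P.reverse.numBends := by
  refine Finset.card_le_card_of_injOn (fun i => P.walk.length - 2 - i) ?_ ?_
  · intro i hi
    have hb := (Finset.mem_filter.1 hi).2
    have := hb.1
    simp only [Finset.coe_filter, Finset.mem_range, length_reverse]
    exact ⟨by omega, hb.reverse⟩
  · intro i hi j hj h
    have := (Finset.mem_filter.1 hi).2.1
    have := (Finset.mem_filter.1 hj).2.1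
    dsimp only at h
    omega

theorem numBends_reverse (P : GridPath) : P.reverse.numBends = P.numBends :=
  le_antisymm (by simpa only [reverse_reverse] using P.reverse.numBends_reverse_le)
    P.numBends_reverse_le

theorem BendsAt.reverse {P : GridPath} {s : Shape} {q : ℤ × ℤ} (h : P.BendsAt s q) :
    P.reverse.BendsAt s q := by
  obtain ⟨h₁, i, hi, hq, hs⟩ := h
  have := hi.1
  refine ⟨by rwa [numBends_reverse], _, hi.reverse, ?_, ?_⟩
  · rw [pt_reverse, show P.walk.length - (P.walk.length - 2 - i + 1) = i + 1 by omega, hq]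
  · rw [pt_reverse, pt_reverse, show P.walk.length - (P.walk.length - 2 - i) = i + 2 by omega,
      show P.walk.length - (P.walk.length - 2 - i + 2) = i by omega, Set.pair_comm, hs]

theorem Traces.of_reverse {P : GridPath} {e : Hook} (h : P.reverse.Traces e) : P.Traces e where
  hasH_iff i j := by rw [← h.hasH_iff, HasH, HasH, edgeSet_reverse]
  hasV_iff i j := by rw [← h.hasV_iff, HasV, HasV, edgeSet_reverse]
  numBends_eq := by rw [← h.numBends_eq, numBends_reverse]
  bendsAt_iff s q := by
    rw [← h.bendsAt_iff]
    exact ⟨fun h => h.reverse, fun h => by simpa only [reverse_reverse] using h.reverse⟩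

/-- A path that consists of `m` horizontal steps followed by `k` vertical ones. -/
theorem exists_traces_of_steps (P : GridPath) {m k : ℕ} (hlen : P.walk.length = m + k)
    (hm : ∀ i < m, (P.pt i).2 = (P.pt (i + 1)).2)
    (hk : ∀ i, m ≤ i → i < m + k → (P.pt i).1 = (P.pt (i + 1)).1) : ∃ e, P.Traces e := by
  obtain ⟨ε, hε, h₁⟩ := Int.exists_eq_add_mul_of_steps (f := fun i => (P.pt (m - i)).1) (n := m)
    (by
      intro i hi
      have := (grid_adj_iff _ _).1 (P.adj_pt_succ (i := m - (i + 1)) (by omega))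
      have := hm (m - (i + 1)) (by omega)
      rw [show m - (i + 1) + 1 = m - i by omega] at *
      omega)
    (by
      intro i hi h
      have h₁ := hm (m - (i + 2)) (by omega)
      have h₂ := hm (m - (i + 1)) (by omega)
      rw [show m - (i + 2) + 1 = m - (i + 1) by omega] at h₁
      rw [show m - (i + 1) + 1 = m - i by omega] at h₂
      have := P.pt_injOn (i := m - (i + 2)) (j := m - i) (by omega) (by omega)
        (Prod.ext h (h₁.trans h₂))
      omega)
  obtain ⟨δ, hδ, h₂⟩ := Int.exists_eq_add_mul_of_steps (f := fun i => (P.pt (m + i)).2) (n := k)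
    (by
      intro i hi
      have := (grid_adj_iff _ _).1 (P.adj_pt_succ (i := m + i) (by omega))
      have := hk (m + i) (by omega) (by omega)
      rw [add_assoc] at *
      omega)
    (by
      intro i hi h
      have h₁ := hk (m + i) (by omega) (by omega)
      have h₂ := hk (m + i + 1) (by omega) (by omega)
      have := P.pt_injOn (i := m + i) (j := m + i + 2) (by omega) (by omega)
        (Prod.ext (h₁.trans h₂) h.symm)
      omega)
  have row : ∀ i ≤ m, (P.pt (m - i)).2 = (P.pt m).2 := by
    intro i
    induction i with
    | zero => simp
    | succ i ih =>
      intro hi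
      rw [hm _ (by omega), show m - (i + 1) + 1 = m - i by omega, ih (by omega)]
  have col : ∀ i ≤ k, (P.pt (m + i)).1 = (P.pt m).1 := by
    intro i
    induction i with
    | zero => simp
    | succ i ih =>
      intro hi
      rw [← add_assoc, ← hk _ (by omega) (by omega), ih (by omega)]
  refine ⟨_, traces_ofArms (x := (P.pt m).1) (y := (P.pt m).2) hε hδ hlen ?_ ?_ ?_⟩
  · intro i hi
    have a := h₁ (m - i) (by omega)
    have b := row (m - i) (by omega)
    rw [show m - (m - i) = i by omega] at a b
    rw [Nat.sub_zero, Nat.cast_sub hi] at a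
    exact ⟨a, b⟩
  · exact fun i hi => ⟨col i hi, h₂ i hi⟩
  · have := P.length_pos
    rcases hε with rfl | rfl <;> rcases hδ with rfl | rfl <;> omega

theorem vertical_iff_of_not_isBend (P : GridPath) {s t : ℕ} (ht : t ≤ P.walk.length)
    (h : ∀ i, s ≤ i → i + 2 ≤ t → ¬ P.IsBend i) {i : ℕ} (hi : s ≤ i) (hit : i + 1 ≤ t) :
    (P.pt i).1 = (P.pt (i + 1)).1 ↔ (P.pt s).1 = (P.pt (s + 1)).1 := by
  induction i, hi using Nat.le_induction with
  | base => rfl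
  | succ i hi ih =>
    rw [← ih (by omega)]
    have := h i hi hit
    simp only [IsBend, not_and, not_not] at this
    exact (this (by omega)).symm

theorem snd_eq_of_not_vertical (P : GridPath) {i : ℕ} (hi : i < P.walk.length)
    (h : ¬ (P.pt i).1 = (P.pt (i + 1)).1) : (P.pt i).2 = (P.pt (i + 1)).2 := by
  have := (grid_adj_iff _ _).1 (P.adj_pt_succ hi)
  omega

theorem exists_traces (P : GridPath) (h : P.numBends ≤ 1) : ∃ e, P.Traces e := by
  have hpos := P.length_pos
  rcases Nat.le_one_iff_eq_zero_or_eq_one.1 h with h | h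
  · have hb : ∀ i, 0 ≤ i → i + 2 ≤ P.walk.length → ¬ P.IsBend i := by
      intro i _ hi hb
      rw [numBends, Finset.card_eq_zero, Finset.filter_eq_empty_iff] at h
      exact h (Finset.mem_range.2 (by omega)) hb
    by_cases hv : (P.pt 0).1 = (P.pt (0 + 1)).1
    · refine P.exists_traces_of_steps (m := 0) (zero_add _).symm (by omega) fun i _ hi => ?_
      exact (P.vertical_iff_of_not_isBend le_rfl hb (Nat.zero_le _) (by omega)).2 hv
    · refine P.exists_traces_of_steps (k := 0) (add_zero _).symm (fun i hi => ?_) (by omega)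
      exact P.snd_eq_of_not_vertical hi
        (mt (P.vertical_iff_of_not_isBend le_rfl hb (Nat.zero_le _) hi).1 hv)
  · obtain ⟨b, hb⟩ := Finset.card_eq_one.1 h
    have huniq : ∀ i, P.IsBend i → i = b := by
      intro i hi
      have := hi.1
      rw [← Finset.mem_singleton, ← hb]
      exact Finset.mem_filter.2 ⟨Finset.mem_range.2 (by omega), hi⟩
    have hbend : P.IsBend b :=
      (Finset.mem_filter.1 (hb ▸ Finset.mem_singleton_self b)).2
    obtain ⟨hbl, hbv⟩ := hbend
    have h₁ : ∀ i, i < b + 1 →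
        ((P.pt i).1 = (P.pt (i + 1)).1 ↔ (P.pt b).1 = (P.pt (b + 1)).1) := by
      have hs : ∀ i, 0 ≤ i → i + 2 ≤ b + 1 → ¬ P.IsBend i := fun i _ hi hb' => by
        have := huniq i hb'
        omega
      intro i hi
      rw [P.vertical_iff_of_not_isBend (by omega) hs (Nat.zero_le i) hi,
        P.vertical_iff_of_not_isBend (by omega) hs (Nat.zero_le b) le_rfl]
    have h₂ : ∀ i, b + 1 ≤ i → i < P.walk.length →
        ((P.pt i).1 = (P.pt (i + 1)).1 ↔ (P.pt (b + 1)).1 = (P.pt (b + 1 + 1)).1) := by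
      intro i hi hil
      refine P.vertical_iff_of_not_isBend le_rfl (fun i hi _ hb' => ?_) hi hil
      have := huniq i hb'
      omega
    by_cases hv : (P.pt b).1 = (P.pt (b + 1)).1
    · -- the vertical arm comes first: traverse the path backwards
      have hv' : ¬ (P.pt (b + 1)).1 = (P.pt (b + 1 + 1)).1 := fun h' => hbv (iff_of_true hv h')
      obtain ⟨e, he⟩ := P.reverse.exists_traces_of_steps (m := P.walk.length - (b + 1))
        (k := b + 1) (by rw [length_reverse]; omega) (by
          intro i hi
          rw [pt_reverse, pt_reverse]
          have := P.snd_eq_of_not_vertical (i := P.walk.length - (i + 1)) (by omega)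
            (mt (h₂ _ (by omega) (by omega)).1 hv')
          rw [this, show P.walk.length - (i + 1) + 1 = P.walk.length - i by omega]) (by
          intro i hi hi'
          rw [pt_reverse, pt_reverse]
          have := (h₁ (P.walk.length - (i + 1)) (by omega)).2 hv
          rw [this, show P.walk.length - (i + 1) + 1 = P.walk.length - i by omega])
      exact ⟨e, he.of_reverse⟩
    · have hv' : (P.pt (b + 1)).1 = (P.pt (b + 1 + 1)).1 := by
        by_contra h'
        exact hbv (iff_of_false hv h')
      refine P.exists_traces_of_steps (m := b + 1) (k := P.walk.length - (b + 1)) (by omega)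
        (fun i hi => P.snd_eq_of_not_vertical (by omega) (mt (h₁ i hi).1 hv))
        (fun i hi hi' => (h₂ i hi (by omega)).2 hv')

theorem exists_walk (n : ℕ) (f : ℕ → ℤ × ℤ) (h : ∀ i < n, grid.Adj (f i) (f (i + 1))) :
    ∃ w : grid.Walk (f 0) (f n), w.length = n ∧ ∀ i ≤ n, w.getVert i = f i := by
  induction n with
  | zero => exact ⟨.nil, rfl, fun i hi => by obtain rfl := Nat.le_zero.1 hi; rfl⟩
  | succ n ih =>
    obtain ⟨w, hw, hf⟩ := ih fun i hi => h i (by omega)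
    refine ⟨w.concat (h n (by omega)), by simp [hw], fun i hi => ?_⟩
    rw [SimpleGraph.Walk.concat_eq_append, SimpleGraph.Walk.getVert_append', hw]
    split_ifs with hin
    · exact hf i hin
    · obtain rfl : i = n + 1 := by omega
      simp

theorem exists_path_traces (e : Hook) : ∃ P : GridPath, P.Traces e := by
  obtain ⟨a, b, h, he⟩ := e.exists_eq_ofArms
  rw [he]
  generalize e.x = x, e.y = y
  have hsign : ∀ c : ℤ, ∃ ε : ℤ, ∃ n : ℕ, (ε = 1 ∨ ε = -1) ∧ c = ε * n := fun c =>
    (le_total 0 c).elim (fun hc => ⟨1, c.toNat, Or.inl rfl, by omega⟩)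
      (fun hc => ⟨-1, (-c).toNat, Or.inr rfl, by omega⟩)
  obtain ⟨ε, m, hε, rfl⟩ := hsign a
  obtain ⟨δ, k, hδ, rfl⟩ := hsign b
  let f : ℕ → ℤ × ℤ := fun i =>
    if i ≤ m then (x + ε * (m - i), y) else (x, y + δ * (i - m))
  have f₁ : ∀ i ≤ m, f i = (x + ε * (m - i), y) := fun i hi => if_pos hi
  have f₂ : ∀ i, m ≤ i → f i = (x, y + δ * (i - m)) := by
    intro i hi
    rcases hi.eq_or_lt with rfl | hi
    · simp [f]
    · exact if_neg (by omega)
  obtain ⟨w, hw, hwf⟩ := exists_walk (m + k) f (by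
    intro i hi
    rw [grid_adj_iff]
    rcases lt_or_ge i m with him | him
    · rw [f₁ i him.le, f₁ (i + 1) him]
      push_cast
      rcases hε with rfl | rfl <;> omega
    · rw [f₂ i him, f₂ (i + 1) (by omega)]
      push_cast
      rcases hδ with rfl | rfl <;> omega)
  have inj : w.IsPath := by
    rw [← SimpleGraph.Walk.IsPath.getVert_injOn_iff]
    intro i hi j hj hij
    simp only [Set.mem_ofPred_eq, hw] at hi hj
    rw [hwf i hi, hwf j hj] at hij
    simp only [f] at hij
    split_ifs at hij <;> rw [Prod.mk.injEq] at hij <;>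
      rcases hε with rfl | rfl <;> rcases hδ with rfl | rfl <;> omega
  have hpos : 0 < w.length := by
    rw [hw]
    rcases hε with rfl | rfl <;> rcases hδ with rfl | rfl <;> omega
  refine ⟨⟨_, _, w, inj, hpos⟩, traces_ofArms hε hδ hw ?_ ?_ h⟩
  · intro i hi
    change (w.getVert i).1 = _ ∧ (w.getVert i).2 = _
    rw [hwf i (by omega), f₁ i hi]
    exact ⟨rfl, rfl⟩
  · intro i hi
    change (w.getVert (m + i)).1 = _ ∧ (w.getVert (m + i)).2 = _
    rw [hwf _ (by omega), f₂ _ (by omega)]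
    refine ⟨rfl, ?_⟩
    push_cast
    rw [add_sub_cancel_left]

end GridPath

/-! ### Representations by hooks -/

namespace GridPath.Traces

variable {P Q : GridPath} {e f : Hook}

theorem intersects_iff (h : P.Traces e) (h' : Q.Traces f) : P.Intersects Q ↔ e.Meets f := by
  rw [GridPath.intersects_iff, Hook.meets_iff_exists]
  simp only [h.hasH_iff, h.hasV_iff, h'.hasH_iff, h'.hasV_iff]

theorem numBends_le (h : P.Traces e) : P.numBends ≤ 1 := by
  rw [h.numBends_eq]; split_ifs <;> decide

theorem hasShape_iff (h : P.Traces e) (s : Shape) :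
    P.HasShape s ↔ (¬ e.Bent ∧ s = .llcorner) ∨ (e.Bent ∧ e.ShapeIs s) := by
  unfold HasShape
  simp only [h.bendsAt_iff, h.numBends_eq]
  by_cases hb : e.Bent <;> simp [hb]

end GridPath.Traces

/-- The hooks represent the graph: distinct vertices are adjacent iff their hooks share an edge. -/
def Hook.Represents {V : Type*} (e : V → Hook) (G : SimpleGraph V) : Prop :=
  ∀ u v, u ≠ v → (G.Adj u v ↔ (e u).Meets (e v))

theorem IsBEPGRep.exists_hooks {V : Type*} {G : SimpleGraph V} {P : V → GridPath}
    (h : IsBEPGRep 1 G P) :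
    ∃ e : V → Hook, (∀ v, (P v).Traces (e v)) ∧ Hook.Represents e G := by
  choose e he using fun v => (P v).exists_traces (h.2 v)
  exact ⟨e, he, fun u v huv => (h.1 u v huv).trans ((he u).intersects_iff (he v))⟩

theorem Hook.Represents.exists_paths {V : Type*} {G : SimpleGraph V} {e : V → Hook}
    (h : Hook.Represents e G) :
    ∃ P : V → GridPath, (∀ v, (P v).Traces (e v)) ∧ IsBEPGRep 1 G P := by
  choose P hP using fun v => GridPath.exists_path_traces (e v)
  exact ⟨P, hP, fun u v huv => (h u v huv).trans ((hP u).intersects_iff (hP v)).symm,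
    fun v => (hP v).numBends_le⟩

/-- When `⌞` is allowed, only bent paths are constrained. -/
theorem mem_shapeClass_iff {S : Set Shape} (hS : .llcorner ∈ S) (G : FinGraph) :
    G ∈ shapeClass S ↔ ∃ e : G.V → Hook, Hook.Represents e G.graph ∧
      ∀ v, (e v).Bent → ∃ s ∈ S, (e v).ShapeIs s := by
  constructor
  · rintro ⟨P, hP, hs⟩
    obtain ⟨e, he, hr⟩ := hP.exists_hooks
    refine ⟨e, hr, fun v hv => ?_⟩
    obtain ⟨s, hsS, h⟩ := hs v
    exact ⟨s, hsS, ((((he v).hasShape_iff s).1 h).resolve_left fun h' => h'.1 hv).2⟩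
  · rintro ⟨e, hr, hs⟩
    obtain ⟨P, hP, hrep⟩ := hr.exists_paths
    refine ⟨P, hrep, fun v => ?_⟩
    by_cases hv : (e v).Bent
    · obtain ⟨s, hsS, h⟩ := hs v hv
      exact ⟨s, hsS, ((hP v).hasShape_iff s).2 (Or.inr ⟨hv, h⟩)⟩
    · exact ⟨_, hS, ((hP v).hasShape_iff _).2 (Or.inl ⟨hv, rfl⟩)⟩

theorem shapeClass_mono {S T : Set Shape} (h : S ⊆ T) : shapeClass S ⊆ shapeClass T :=
  fun _ ⟨P, hP, hs⟩ => ⟨P, hP, fun v => let ⟨s, hsS, hv⟩ := hs v; ⟨s, h hsS, hv⟩⟩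

/-! ### Criteria for the Helly property -/

theorem GridPath.intersects_self (P : GridPath) : P.Intersects P := by
  have := P.length_pos
  exact ⟨s(P.pt 0, P.pt 1), (P.mk_mem_edgeSet_iff _ _).2 ⟨0, this, rfl⟩,
    (P.mk_mem_edgeSet_iff _ _).2 ⟨0, this, rfl⟩⟩

theorem exists_mem_grid_edgeSet : ∃ e, e ∈ grid.edgeSet :=
  ⟨_, (GridPath.mem_grid_edgeSet_iff _).2 ⟨0, 0, Or.inl rfl⟩⟩

theorem IsEPGRep.isHelly_of_triangleFree {V : Type*} {G : SimpleGraph V} {P : V → GridPath}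
    (h : IsEPGRep G P) (hG : ∀ u v w, G.Adj u v → G.Adj v w → ¬ G.Adj u w) : IsHelly P := by
  intro A hA
  rcases A.eq_empty_or_nonempty with rfl | ⟨u, hu⟩
  · obtain ⟨e, he⟩ := exists_mem_grid_edgeSet
    exact ⟨e, he, by simp⟩
  have : ∃ v ∈ A, ∀ w ∈ A, w = u ∨ w = v := by
    by_contra! hcon
    obtain ⟨v, hv, hvu, -⟩ := hcon u hu
    obtain ⟨w, hw, hwu, hwv⟩ := hcon v hv
    exact hG u v w ((h u v hvu.symm).2 (hA u hu v hv)) ((h v w hwv.symm).2 (hA v hv w hw))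
      ((h u w hwu.symm).2 (hA u hu w hw))
  obtain ⟨v, hv, hAv⟩ := this
  obtain ⟨e, heu, hev⟩ := hA u hu v hv
  refine ⟨e, (P u).edgeSet_subset heu, fun w hw => ?_⟩
  rcases hAv w hw with rfl | rfl <;> assumption

/-- Pairwise intersecting paths of shapes `⌞` and `⌝` intersect pairwise in one row or pairwise in
one column, where the Helly property of intervals applies. -/
theorem isHelly_of_isDiagonal {V : Type*} [Finite V] {P : V → GridPath} {e : V → Hook}
    (hP : ∀ v, (P v).Traces (e v)) (hd : ∀ v, (e v).IsDiagonal) : IsHelly P := by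
  intro A hA
  rcases A.eq_empty_or_nonempty with rfl | hne
  · obtain ⟨e, he⟩ := exists_mem_grid_edgeSet
    exact ⟨e, he, by simp⟩
  have hA' : ∀ u ∈ A, ∀ v ∈ A, (e u).Meets (e v) := fun u hu v hv =>
    ((hP u).intersects_iff (hP v)).1 (hA u hu v hv)
  rw [GridPath.exists_edge_iff]
  rcases Hook.forall_meetsH_or_forall_meetsV hd hA' with h | h
  · obtain ⟨y, t, ht⟩ := Hook.exists_common_hasV (e := fun v => (e v).swap) hne h
    exact ⟨t, y, Or.inl fun v hv => ((hP v).hasH_iff t y).2 (ht v hv)⟩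
  · obtain ⟨x, t, ht⟩ := Hook.exists_common_hasV hne h
    exact ⟨x, t, Or.inr fun v hv => ((hP v).hasV_iff x t).2 (ht v hv)⟩

theorem shapeClass_diagonal_subset_hellyBEPG :
    shapeClass {Shape.llcorner, Shape.urcorner} ⊆ HellyBEPG 1 := by
  intro G hG
  obtain ⟨e, hr, hs⟩ := (mem_shapeClass_iff (by simp) G).1 hG
  obtain ⟨P, hP, hrep⟩ := hr.exists_paths
  have := G.finite
  refine ⟨P, hrep, isHelly_of_isDiagonal hP fun v hv => ?_⟩
  simpa using hs v hv

/-! ### Decidability of adjacency -/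

instance (V W : Type*) : DecidableRel (completeBipartiteGraph V W).Adj := fun u v =>
  inferInstanceAs (Decidable (u.isLeft ∧ v.isRight ∨ u.isRight ∧ v.isLeft))

instance : DecidableRel batGraph.Adj := fun p q =>
  inferInstanceAs (Decidable (p.1 = q.1 ∧ (completeBipartiteGraph (Fin 2) (Fin 4)).Adj p.2 q.2 ∨
    (p.2 = Sum.inr 0 ∧ q.2 = Sum.inr 0 ∧ (SimpleGraph.cycleGraph 4).Adj p.1 q.1)))

instance : DecidableRel threeSun.Adj
  | Sum.inl i, Sum.inl j => inferInstanceAs (Decidable (i ≠ j))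
  | Sum.inl i, Sum.inr j => inferInstanceAs (Decidable (i ≠ j))
  | Sum.inr i, Sum.inl j => inferInstanceAs (Decidable (i ≠ j))
  | Sum.inr _, Sum.inr _ => inferInstanceAs (Decidable False)

/-! ### `K_{2,4}` separates `[⌞]` from `[⌞,⌝]` -/

/-- Two paths of shapes `⌞` and `⌝` that cross at `(0, 3)` and `(3, 0)`, and at each of these points
two short paths of the same two shapes. -/
def k24Hook : Fin 2 ⊕ Fin 4 → Hook
  | .inl 0 => .ofArms 0 0 4 4 (by decide)
  | .inl 1 => .ofArms 3 3 (-4) (-4) (by decide)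
  | .inr 0 => .ofArms 0 3 1 1 (by decide)
  | .inr 1 => .ofArms 0 3 (-1) (-1) (by decide)
  | .inr 2 => .ofArms 3 0 1 1 (by decide)
  | .inr 3 => .ofArms 3 0 (-1) (-1) (by decide)

theorem k24_mem_shapeClass : FinGraph.mk _ (completeBipartiteGraph (Fin 2) (Fin 4)) ∈
    shapeClass {Shape.llcorner, Shape.urcorner} := by
  rw [mem_shapeClass_iff (by simp)]
  refine ⟨k24Hook, ?_, ?_⟩
  · unfold Hook.Represents
    decide
  · have : ∀ v, (k24Hook v).ShapeIs .llcorner ∨ (k24Hook v).ShapeIs .urcorner := by decide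
    intro v _
    simpa using this v

theorem k24_not_mem_shapeClass : FinGraph.mk _ (completeBipartiteGraph (Fin 2) (Fin 4)) ∉
    shapeClass {Shape.llcorner} := by
  rw [mem_shapeClass_iff (by simp)]
  rintro ⟨e, hr, hs⟩
  refine Hook.not_all_llcorner (a := e (.inl 0)) (b := e (.inl 1)) (c := fun i => e (.inr i))
    ?_ ?_ ?_ ?_ ?_
  · rw [← hr _ _ (by simp)]; simp
  · intro i j hij
    rw [← hr _ _ (by simpa using hij)]; simp
  · intro i
    rw [← hr _ _ (by simp)]; simp
  · intro i
    rw [← hr _ _ (by simp)]; simp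
  · intro i hi
    simpa using hs _ hi

/-! ### The bat graph -/

/-- The bend of each path of the `4`-cycle is surrounded by paths of its copy of `K_{2,4}`, which
are not adjacent to the other three paths of the cycle; so these do not touch the bend. -/
theorem exists_perm_isFrame_batGraph {e : Fin 4 × (Fin 2 ⊕ Fin 4) → Hook}
    (h : Hook.Represents e batGraph) :
    ∃ σ : Equiv.Perm (Fin 4), Hook.IsFrame (e (σ 0, .inr 0)) (e (σ 1, .inr 0))
        (e (σ 2, .inr 0)) (e (σ 3, .inr 0)) ∧ (∀ i, (e (i, .inr 0)).Bent) ∧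
      ((e (σ 0, .inr 0)).Meets (e (σ 1, .inr 0)) ∧ (e (σ 0, .inr 0)).Meets (e (σ 2, .inr 0)) ∧
        (e (σ 1, .inr 0)).Meets (e (σ 3, .inr 0)) ∧ (e (σ 2, .inr 0)).Meets (e (σ 3, .inr 0)) ∧
        ¬ (e (σ 0, .inr 0)).Meets (e (σ 3, .inr 0)) ∧
        ¬ (e (σ 1, .inr 0)).Meets (e (σ 2, .inr 0))) := by
  have crossed : ∀ i, (e (i, .inr 0)).Crossed (e (i, .inl 0)) (e (i, .inl 1)) ∨
      (e (i, .inr 0)).Crossed (e (i, .inl 1)) (e (i, .inl 0)) := by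
    intro i
    refine Hook.crossed_or_crossed (c := fun k => e (i, .inr k)) ?_ ?_ ?_ ?_ 0
    · rw [← h _ _ (by simp)]; simp [batGraph]
    · intro k l hkl
      rw [← h _ _ (by simpa using hkl)]
      revert i k l; decide
    · intro k
      rw [← h _ _ (by simp)]; simp [batGraph]
    · intro k
      rw [← h _ _ (by simp)]; simp [batGraph]
  have avoids : ∀ i j, i ≠ j →
      (e (j, .inr 0)).Avoids (e (i, .inr 0)).x (e (i, .inr 0)).y := by
    intro i j hij
    have : ∀ k, ¬ (e (j, .inr 0)).Meets (e (i, .inl k)) := by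
      intro k
      rw [← h _ _ (by simp)]; simp [batGraph, hij.symm]
    rcases crossed i with hc | hc <;> exact hc.avoids (this _) (this _)
  have meets : ∀ i, (e (i, .inr 0)).Meets (e (i + 1, .inr 0)) := by
    intro i
    refine (h _ _ ?_).1 ?_ <;> clear crossed avoids <;> revert i <;> decide
  have not_meets : ∀ i, ¬ (e (i, .inr 0)).Meets (e (i + 2, .inr 0)) := by
    intro i
    refine mt (h _ _ ?_).2 ?_ <;> clear crossed avoids meets <;> revert i <;> decide
  obtain ⟨σ, hσ, h₀₁, h₀₂, h₁₃, h₂₃, h₀₃, h₁₂⟩ :=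
    Hook.exists_perm_isFrame (c := fun i => e (i, .inr 0)) meets not_meets avoids
  have meets' : ∀ i j : Fin 4, j = i + 1 ∨ i = j + 1 →
      (e (i, .inr 0)).Meets (e (j, .inr 0)) := by
    rintro i j (rfl | rfl)
    · exact meets i
    · exact (meets j).symm
  refine ⟨σ, hσ, fun i => (crossed i).elim And.left And.left, meets' _ _ h₀₁, meets' _ _ h₀₂,
    meets' _ _ h₁₃, meets' _ _ h₂₃, ?_, ?_⟩
  · rw [h₀₃]; exact not_meets _
  · rw [h₁₂]; exact not_meets _

theorem isSquareFrame_batGraph {P : Fin 4 × (Fin 2 ⊕ Fin 4) → GridPath}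
    (h : IsBEPGRep 1 batGraph P) :
    ∃ σ : Equiv.Perm (Fin 4), IsSquareFrame (P (σ 0, .inr 0)) (P (σ 1, .inr 0))
      (P (σ 2, .inr 0)) (P (σ 3, .inr 0)) := by
  obtain ⟨e, he, hr⟩ := h.exists_hooks
  obtain ⟨σ, ⟨⟨hx, hy, h₂, h₃, h₄, h₅⟩, s₁, s₂, s₃, s₄⟩, hb, hm⟩ :=
    exists_perm_isFrame_batGraph hr
  refine ⟨σ, ⟨_, _, _, _, hx, hy, ((he _).bendsAt_iff _ _).2 ⟨hb _, s₁, rfl⟩,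
    ((he _).bendsAt_iff _ _).2 ⟨hb _, s₂, Prod.ext rfl h₂.symm⟩,
    ((he _).bendsAt_iff _ _).2 ⟨hb _, s₃, Prod.ext h₃.symm rfl⟩,
    ((he _).bendsAt_iff _ _).2 ⟨hb _, s₄, Prod.ext h₄.symm h₅.symm⟩⟩, ?_⟩
  simpa only [(he _).intersects_iff (he _)] using hm

theorem batGraph_not_mem_shapeClass {S : Set Shape} (hS : .llcorner ∈ S)
    (hS' : .lrcorner ∉ S) : FinGraph.mk _ batGraph ∉ shapeClass S := by
  rw [mem_shapeClass_iff hS]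
  rintro ⟨e, hr, hs⟩
  obtain ⟨σ, ⟨-, -, s₂, -⟩, hb, -⟩ := exists_perm_isFrame_batGraph hr
  obtain ⟨s, hsS, h⟩ := hs _ (hb (σ 1))
  have := hb (σ 1)
  -- the shape of a bent hook is unique
  cases s <;> simp only [Hook.ShapeIs, Hook.Bent] at * <;> first | omega | exact hS' hsS

/-- A representation of `K_{2,4}`, given by the bend point `(x, y)` and the signed arm lengths
`(a, b)` of each hook, as the quadruple `(x, y, a, b)`. Hook `inr 0` bends at the
origin and has long arms to the right and up; everything else stays within distance `1` of the lower left quadrant. -/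
def batGadget : Fin 2 ⊕ Fin 4 → ℤ × ℤ × ℤ × ℤ
  | .inl 0 => (0, -2, -3, 3)
  | .inl 1 => (-2, 0, 3, -3)
  | .inr 0 => (0, 0, 6, 6)
  | .inr 1 => (0, 0, -1, -1)
  | .inr 2 => (-2, -2, 1, 1)
  | .inr 3 => (-2, -2, -1, -1)

/-- The corners `(x, y)` of a square of side `10` in cyclic order, each with the signs of the two
reflections that turn the long arms of the gadget into the square. -/
def batCorner : Fin 4 → ℤ × ℤ × ℤ × ℤ :=
  ![(0, 0, 1, 1), (10, 0, -1, 1), (10, 10, -1, -1), (0, 10, 1, -1)]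

/-- At each corner of the square, a reflected copy of the gadget. The long arms have length `6`, so
those of neighbouring corners overlap. -/
def batHook (v : Fin 4 × (Fin 2 ⊕ Fin 4)) : Hook :=
  .ofArms ((batCorner v.1).1 + (batCorner v.1).2.2.1 * (batGadget v.2).1)
    ((batCorner v.1).2.1 + (batCorner v.1).2.2.2 * (batGadget v.2).2.1)
    ((batCorner v.1).2.2.1 * (batGadget v.2).2.2.1)
    ((batCorner v.1).2.2.2 * (batGadget v.2).2.2.2) (by revert v; decide)

theorem batHook_represents : Hook.Represents batHook batGraph := by
  unfold Hook.Represents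
  decide

theorem batGraph_mem_hellyBEPG : FinGraph.mk _ batGraph ∈ HellyBEPG 1 := by
  obtain ⟨P, -, hP⟩ := batHook_represents.exists_paths
  refine ⟨P, hP, hP.1.isHelly_of_triangleFree ?_⟩
  decide

/-! ### The `3`-sun -/

/-- The triangle is represented at the origin by a vertical path and paths of shapes `⌞` and `⌜`,
which pairwise share the edge upwards, downwards or to the right; each further path is a piece of
one of these three arms. -/
def sunHook : Fin 3 ⊕ Fin 3 → Hook
  | .inl 0 => .ofArms 0 (-2) 0 4 (by decide)
  | .inl 1 => .ofArms 0 0 2 2 (by decide)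
  | .inl 2 => .ofArms 0 0 2 (-2) (by decide)
  | .inr 0 => .ofArms 1 0 1 0 (by decide)
  | .inr 1 => .ofArms 0 (-2) 0 1 (by decide)
  | .inr 2 => .ofArms 0 1 0 1 (by decide)

theorem threeSun_mem_shapeClass : FinGraph.mk _ threeSun ∈
    shapeClass {Shape.llcorner, Shape.ulcorner} := by
  rw [mem_shapeClass_iff (by simp)]
  refine ⟨sunHook, ?_, ?_⟩
  · unfold Hook.Represents
    decide
  · have : ∀ v, (sunHook v).Bent →
        (sunHook v).ShapeIs .llcorner ∨ (sunHook v).ShapeIs .ulcorner := by decide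
    intro v hv
    simpa using this v hv

/-- By the Helly property, the paths of the triangle share a grid edge, which a reflection makes
horizontal. -/
theorem threeSun_not_mem_hellyBEPG : FinGraph.mk _ threeSun ∉ HellyBEPG 1 := by
  rintro ⟨P, hP, hH⟩
  obtain ⟨e, he, hr⟩ := hP.exists_hooks
  dsimp only at P e he hr
  have hab : ∀ i j : Fin 3, (e (.inr i)).Meets (e (.inl j)) ↔ i ≠ j := fun i j =>
    (hr _ _ (by simp)).symm
  have hbb : ∀ i j : Fin 3, i ≠ j → ¬ (e (.inr i)).Meets (e (.inr j)) := fun i j hij =>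
    mt (hr _ _ (by simpa using hij)).2 id
  obtain ⟨t, y, h | h⟩ := (GridPath.exists_edge_iff _).1 (hH (Set.range Sum.inl) (by
    rintro _ ⟨i, rfl⟩ _ ⟨j, rfl⟩
    rcases eq_or_ne i j with rfl | hij
    · exact GridPath.intersects_self _
    · exact (hP.1 _ _ (by simpa using hij)).1 hij))
  · exact Hook.not_sun (a := fun i => e (.inl i)) (b := fun i => e (.inr i)) (t := t) (y := y)
      (fun i => ((he _).hasH_iff t y).1 (h _ ⟨i, rfl⟩)) hab hbb
  · exact Hook.not_sun (a := fun i => (e (.inl i)).swap) (b := fun i => (e (.inr i)).swap)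
      (t := y) (y := t) (fun i => ((he _).hasV_iff t y).1 (h _ ⟨i, rfl⟩))
      (fun i j => Hook.swap_meets_swap.trans (hab i j))
      (fun i j hij => mt Hook.swap_meets_swap.1 (hbb i j hij))

theorem mainTheorem7 :
    -- the strict inclusions `[⌞] ⊊ [⌞,⌝] ⊊ Helly-B₁ EPG`
    shapeClass {Shape.llcorner} ⊂ shapeClass {Shape.llcorner, Shape.urcorner} ∧
    shapeClass {Shape.llcorner, Shape.urcorner} ⊂ HellyBEPG 1 ∧
    -- Helly-`B₁` EPG is incomparable with `[⌞,⌜]`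
    (¬ HellyBEPG 1 ⊆ shapeClass {Shape.llcorner, Shape.ulcorner} ∧
      ¬ shapeClass {Shape.llcorner, Shape.ulcorner} ⊆ HellyBEPG 1) ∧
    -- Helly-`B₁` EPG is incomparable with `[⌞,⌜,⌝]`
    (¬ HellyBEPG 1 ⊆ shapeClass {Shape.llcorner, Shape.ulcorner, Shape.urcorner} ∧
      ¬ shapeClass {Shape.llcorner, Shape.ulcorner, Shape.urcorner} ⊆ HellyBEPG 1) ∧
    -- the bat graph: every single bend representation represents its `C₄` by a square-frame,
    -- and the graph separates Helly-`B₁` EPG from the three larger shape classes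
    (∀ P : Fin 4 × (Fin 2 ⊕ Fin 4) → GridPath, IsBEPGRep 1 batGraph P →
      ∃ σ : Equiv.Perm (Fin 4), IsSquareFrame (P (σ 0, Sum.inr 0)) (P (σ 1, Sum.inr 0))
        (P (σ 2, Sum.inr 0)) (P (σ 3, Sum.inr 0))) ∧
    (FinGraph.mk _ batGraph ∈ HellyBEPG 1 ∧
      FinGraph.mk _ batGraph ∉ shapeClass {Shape.llcorner, Shape.urcorner} ∧
      FinGraph.mk _ batGraph ∉ shapeClass {Shape.llcorner, Shape.ulcorner} ∧
      FinGraph.mk _ batGraph ∉ shapeClass {Shape.llcorner, Shape.ulcorner, Shape.urcorner}) ∧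
    -- the 3-sun separates `[⌞,⌜]` and `[⌞,⌜,⌝]` from Helly-`B₁` EPG
    (FinGraph.mk _ threeSun ∈ shapeClass {Shape.llcorner, Shape.ulcorner} ∧
      FinGraph.mk _ threeSun ∈ shapeClass {Shape.llcorner, Shape.ulcorner, Shape.urcorner} ∧
      FinGraph.mk _ threeSun ∉ HellyBEPG 1) := by
  have bat₂ : FinGraph.mk _ batGraph ∉ shapeClass {Shape.llcorner, Shape.urcorner} :=
    batGraph_not_mem_shapeClass (by simp) (by simp)
  have bat₃ : FinGraph.mk _ batGraph ∉ shapeClass {Shape.llcorner, Shape.ulcorner} :=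
    batGraph_not_mem_shapeClass (by simp) (by simp)
  have bat₄ : FinGraph.mk _ batGraph ∉
      shapeClass {Shape.llcorner, Shape.ulcorner, Shape.urcorner} :=
    batGraph_not_mem_shapeClass (by simp) (by simp)
  have sun : FinGraph.mk _ threeSun ∈
      shapeClass {Shape.llcorner, Shape.ulcorner, Shape.urcorner} :=
    shapeClass_mono (by simp [Set.insert_subset_iff]) threeSun_mem_shapeClass
  refine ⟨⟨shapeClass_mono (by simp), fun h => ?_⟩,
    ⟨shapeClass_diagonal_subset_hellyBEPG, fun h => bat₂ (h batGraph_mem_hellyBEPG)⟩,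
    ⟨fun h => bat₃ (h batGraph_mem_hellyBEPG),
      fun h => threeSun_not_mem_hellyBEPG (h threeSun_mem_shapeClass)⟩,
    ⟨fun h => bat₄ (h batGraph_mem_hellyBEPG), fun h => threeSun_not_mem_hellyBEPG (h sun)⟩,
    fun P hP => isSquareFrame_batGraph hP,
    ⟨batGraph_mem_hellyBEPG, bat₂, bat₃, bat₄⟩,
    threeSun_mem_shapeClass, sun, threeSun_not_mem_hellyBEPG⟩
  exact k24_not_mem_shapeClass (h k24_mem_shapeClass)
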